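/- Let $\Phi$ be a real $m\times N$ matrix whose columns $\phi_1,\dots,\phi_N$ have Euclidean norm $1$, and let $1\le k\le N$ be an integer. For $i\ne j$ put $\mu_{i,j}=|\langle\phi_i,\phi_j\rangle|$, let $\mu=\max_{i\ne j}\mu_{i,j}$ be the mutual coherence and $\bar\mu^2=\max_{1\le j\le N}\frac1{N-1}\sum_{i\ne j}\mu_{i,j}^2$ the mean square coherence of $\Phi$ (both are $0$ if $N=1$). Let $\|\cdot\|$ denote the spectral norm (largest singular value) and $\log$ the natural logarithm. Let $\delta\in\mathbb R$, let $$0<\epsilon<\min\{1/k,\;e^{1-1/\log 2}\},$$ and suppose that $a,b,c\in(0,1)$ satisfy $$k\mu^4\le\frac1{\log^2(1/\epsilon)}\min\Big(\frac{(1-a)^2b^2}{32\,\log(2k)\,\log(e/\epsilon)},\;c^2\Big),\qquad k\bar\mu^2\le\frac{ab}{\log(1/\epsilon)},$$ $$\sqrt b+\sqrt{2ab}+\sqrt c+\frac{2k}{N}\|\Phi\|^2\le\frac{e^{-1/4}\,\delta}{6\sqrt2}.$$ Then $\Phi$ is $(k,\delta,\epsilon)$-StRIP: if $I$ is a $k$-subset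 of $\{1,\dots,N\}$ chosen uniformly at random and $\Phi_I$ is the $m\times k$ submatrix of $\Phi$ formed of the columns with indices in $I$, then $$P\big(\|\Phi_I^T\Phi_I-\mathrm{Id}\|\ge\delta\big)<\epsilon .$$ -/

import Mathlib

namespace StRIP

section Norm

open scoped Matrix.Norms.L2Operator

/-- The spectral norm of a real matrix: its largest singular value, that is, the norm of the
operator it defines between Euclidean spaces. -/
noncomputable def specNorm {m n : Type*} [Fintype m] [Fintype n] [DecidableEq n]
    (A : Matrix m n ℝ) : ℝ :=
  ‖A‖

end Norm

/-- The coherence of columns `i` and `j`: the absolute value of their inner product. -/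
noncomputable def coh {m N : ℕ} (Φ : Matrix (Fin m) (Fin N) ℝ) (i j : Fin N) : ℝ :=
  |∑ t, Φ t i * Φ t j|

/-- Mutual coherence: the largest coherence of two different columns
(`0` if there are no two different columns). -/
noncomputable def mutualCoherence {m N : ℕ} (Φ : Matrix (Fin m) (Fin N) ℝ) : ℝ :=
  ⨆ p : {p : Fin N × Fin N // p.1 ≠ p.2}, coh Φ p.1.1 p.1.2

/-- Mean square coherence: the largest, over the columns `j`, of the average of the squared
coherences of `j` with the other columns. -/
noncomputable def meanSqCoherence {m N : ℕ} (Φ : Matrix (Fin m) (Fin N) ℝ) : ℝ :=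
  ⨆ j : Fin N, 1 / ((N : ℝ) - 1) * ∑ i ∈ Finset.univ.erase j, coh Φ i j ^ 2

/-- All columns have Euclidean norm `1`. -/
def UnitColumns {m N : ℕ} (Φ : Matrix (Fin m) (Fin N) ℝ) : Prop :=
  ∀ j, ∑ t, Φ t j ^ 2 = 1

/-- The submatrix formed of the columns with indices in `I`. -/
def colSub {m N : ℕ} (Φ : Matrix (Fin m) (Fin N) ℝ) (I : Finset (Fin N)) :
    Matrix (Fin m) I ℝ :=
  Φ.submatrix id (fun i : I => (i : Fin N))

/-- The deviation of the Gram matrix of the columns in `I` from the identity. -/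
noncomputable def gramDev {m N : ℕ} (Φ : Matrix (Fin m) (Fin N) ℝ) (I : Finset (Fin N)) : ℝ :=
  specNorm ((colSub Φ I).transpose * colSub Φ I - 1)

/-- The probability of the event `E` for a uniformly random `k`-subset of the `N` indices. -/
noncomputable def probSubset (N k : ℕ) (E : Set (Finset (Fin N))) : ℝ :=
  open Classical in
  (((Finset.powersetCard k (Finset.univ : Finset (Fin N))).filter (fun I => I ∈ E)).card : ℝ) /
    ((Finset.powersetCard k (Finset.univ : Finset (Fin N))).card : ℝ)

/-- The `(k, δ, ε)` statistical restricted isometry property. -/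
def IsStRIP {m N : ℕ} (Φ : Matrix (Fin m) (Fin N) ℝ) (k : ℕ) (δ ε : ℝ) : Prop :=
  probSubset N k {I | δ ≤ gramDev Φ I} < ε

end StRIP

namespace StRIP

open Finset Matrix

/-! Put `H = ΦᵀΦ - Id` and `L = log (1/ε)`. The deviation of `I` is the spectral norm of `H` on `I ×
I`. For `k = 1` it is `0`, and for `N ≤ 2k` it is at most `‖Φ‖² < δ` for every `I`. Otherwise there
are two bad events.

Either some `j ∈ I` has `∑ H i j ^ 2 ≥ b/L` over the other `i ∈ I`. The mean of such a sum is at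
most `ab/L` by the bound on the mean square coherence. An exponential moment for sampling without
replacement (`card_filter_sum_ge_le`) and a union bound give probability at most `ε/4`.

Or no column is like that and still the deviation is at least `δ`. This is treated by Markov's
inequality for the moment of order `2q`, `q = ⌈6L⌉`. Decoupling (`quadForm_pow_le_sum_trace`)
replaces `I × I` by the blocks `T × (I \ T)` with `T ⊆ I`. For fixed `T` the columns of the block
are randomly sampled; truncated at squared length `b/L`, they obey the moment bound
`sum_trace_rankOneSum_pow_le` in terms of the rows of `H` in `T`. The same bound, applied to the
random set `T`, controls these rows through `‖Φ‖` and the mean square coherence. Outside the first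
event the truncation changes nothing. The probability is at most `3k²e^{-q} ≤ 3ε⁴ ≤ 3ε/8`.

The moment bound rests on leaving one index out: `tr S_I^{p+1} = ∑ vᵢᵀ S_I^p vᵢ` over `i ∈ I`, where
`S_I = ∑ vᵢvᵢᵀ`. Inside `S_I` the summand `vᵢvᵢᵀ` may be replaced by `R · Id`
(`moment_add_vecMulVec_le`). What remains depends on `I \ {i}`, and a binomial expansion gives a
recursion over lower moments. -/

lemma dotProduct_self_nonneg {n : Type*} [Fintype n] (x : n → ℝ) : 0 ≤ x ⬝ᵥ x :=
  sum_nonneg fun i _ => mul_self_nonneg (x i)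

/-! ### Moments `xᵀAᵏx` and `tr Aᵏ` of a positive semidefinite matrix. -/

section SpectralMoments

variable {n : Type*} [Fintype n] [DecidableEq n]

/-- Spectral decomposition of the moments of a positive semidefinite matrix. -/
lemma exists_spectral_moments {A : Matrix n n ℝ} (hA : A.PosSemidef) :
    ∃ (u : n → n → ℝ) (l : n → ℝ), (∀ s, 0 ≤ l s) ∧ (∀ s, u s ⬝ᵥ u s = 1) ∧
      (∀ x, ∑ s, (u s ⬝ᵥ x) ^ 2 = x ⬝ᵥ x) ∧
      (∀ (k : ℕ) x, x ⬝ᵥ (A ^ k *ᵥ x) = ∑ s, l s ^ k * (u s ⬝ᵥ x) ^ 2) ∧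
      ∀ k : ℕ, (A ^ k).trace = ∑ s, l s ^ k := by
  have hH := hA.1
  set U : Matrix n n ℝ := (hH.eigenvectorUnitary : Matrix n n ℝ) with hU
  have h1 : Uᵀ * U = 1 := by
    have := Unitary.coe_star_mul_self hH.eigenvectorUnitary
    rwa [star_eq_conjTranspose, conjTranspose_eq_transpose_of_trivial] at this
  have h2 : U * Uᵀ = 1 := mul_eq_one_comm.1 h1
  have hspec : A = U * diagonal hH.eigenvalues * Uᵀ := by
    have := hH.spectral_theorem
    rw [Unitary.conjStarAlgAut_apply, star_eq_conjTranspose,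
      conjTranspose_eq_transpose_of_trivial] at this
    simpa using this
  have hpow : ∀ k : ℕ, A ^ k = U * diagonal (fun s => hH.eigenvalues s ^ k) * Uᵀ := by
    intro k
    induction k with
    | zero => simp [h2]
    | succ k ih =>
      rw [pow_succ, ih]
      nth_rewrite 2 [hspec]
      calc U * diagonal (fun s => hH.eigenvalues s ^ k) * Uᵀ * (U * diagonal hH.eigenvalues * Uᵀ)
          = U * diagonal (fun s => hH.eigenvalues s ^ k) * (Uᵀ * U) * diagonal hH.eigenvalues
            * Uᵀ := by simp only [Matrix.mul_assoc]
        _ = _ := by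
          rw [h1, Matrix.mul_one, Matrix.mul_assoc U, diagonal_mul_diagonal]
          simp only [pow_succ]
  have hdot : ∀ s x, (Uᵀ *ᵥ x) s = (fun t => U t s) ⬝ᵥ x := fun s x => rfl
  have hq : ∀ (k : ℕ) x, x ⬝ᵥ (A ^ k *ᵥ x)
      = ∑ s, hH.eigenvalues s ^ k * ((fun t => U t s) ⬝ᵥ x) ^ 2 := by
    intro k x
    rw [hpow, ← mulVec_mulVec, ← mulVec_mulVec, dotProduct_mulVec, ← mulVec_transpose]
    simp only [dotProduct, mulVec_diagonal]
    refine sum_congr rfl fun s _ => ?_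
    rw [hdot]; simp only [dotProduct]; ring
  refine ⟨fun s t => U t s, hH.eigenvalues, hA.eigenvalues_nonneg, ?_, ?_, hq, ?_⟩
  · intro s
    have := congrFun (congrFun h1 s) s
    simpa [Matrix.mul_apply, dotProduct] using this
  · intro x
    have := hq 0 x
    simpa using this.symm
  · intro k
    rw [hpow, Matrix.trace_mul_comm, ← Matrix.mul_assoc, h1, Matrix.one_mul, trace_diagonal]

lemma dotProduct_pow_mulVec_nonneg {A : Matrix n n ℝ} (hA : A.PosSemidef) (x : n → ℝ) (k : ℕ) :
    0 ≤ x ⬝ᵥ (A ^ k *ᵥ x) := by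
  obtain ⟨u, l, hl, -, -, hq, -⟩ := exists_spectral_moments hA
  rw [hq]
  exact sum_nonneg fun s _ => mul_nonneg (pow_nonneg (hl s) _) (sq_nonneg _)

lemma trace_pow_nonneg {A : Matrix n n ℝ} (hA : A.PosSemidef) (k : ℕ) :
    0 ≤ (A ^ k).trace := by
  obtain ⟨u, l, hl, -, -, -, ht⟩ := exists_spectral_moments hA
  rw [ht]
  exact sum_nonneg fun s _ => pow_nonneg (hl s) _

/-- Chebyshev's correlation inequality for the moments of a positive semidefinite matrix. -/
lemma moment_mul_moment_le {A : Matrix n n ℝ} (hA : A.PosSemidef) (x : n → ℝ) (i j : ℕ) :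
    (x ⬝ᵥ (A ^ i *ᵥ x)) * (x ⬝ᵥ (A ^ j *ᵥ x)) ≤ (x ⬝ᵥ x) * (x ⬝ᵥ (A ^ (i + j) *ᵥ x)) := by
  obtain ⟨u, l, hl, -, h0, hq, -⟩ := exists_spectral_moments hA
  rw [hq, hq, hq, ← h0]
  set w : n → ℝ := fun s => (u s ⬝ᵥ x) ^ 2 with hw
  have hw0 : ∀ s, 0 ≤ w s := fun s => sq_nonneg _
  -- The powers `l ^ i` and `l ^ j` are similarly ordered, so every term of the symmetrized double
  -- sum is nonnegative.
  have key : 0 ≤ ∑ s, ∑ t, w s * w t * ((l s ^ i - l t ^ i) * (l s ^ j - l t ^ j)) := by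
    refine sum_nonneg fun s _ => sum_nonneg fun t _ =>
      mul_nonneg (mul_nonneg (hw0 s) (hw0 t)) ?_
    rcases le_total (l s) (l t) with h | h
    · exact mul_nonneg_of_nonpos_of_nonpos
        (sub_nonpos.2 (pow_le_pow_left₀ (hl s) h i)) (sub_nonpos.2 (pow_le_pow_left₀ (hl s) h j))
    · exact mul_nonneg
        (sub_nonneg.2 (pow_le_pow_left₀ (hl t) h i)) (sub_nonneg.2 (pow_le_pow_left₀ (hl t) h j))
  have expand : ∑ s, ∑ t, w s * w t * ((l s ^ i - l t ^ i) * (l s ^ j - l t ^ j))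
      = 2 * ((∑ s, w s) * ∑ s, l s ^ (i + j) * w s)
        - 2 * ((∑ s, l s ^ i * w s) * ∑ s, l s ^ j * w s) := by
    have e1 : ∀ s t, w s * w t * ((l s ^ i - l t ^ i) * (l s ^ j - l t ^ j))
        = (l s ^ (i + j) * w s) * w t + w s * (l t ^ (i + j) * w t)
          - (l s ^ i * w s) * (l t ^ j * w t) - (l s ^ j * w s) * (l t ^ i * w t) := by
      intro s t; ring
    simp only [e1, sum_sub_distrib, sum_add_distrib, ← sum_mul_sum]
    ring
  linarith

/-- Adding a rank-one term `v vᵀ` with `|v|² ≤ R` moves the moments along `v` by no more than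
adding `R` times the identity. -/
lemma moment_add_vecMulVec_le {A : Matrix n n ℝ} (hA : A.PosSemidef) {v : n → ℝ} {R : ℝ}
    (hv : v ⬝ᵥ v ≤ R) (k : ℕ) :
    v ⬝ᵥ ((A + vecMulVec v v) ^ k *ᵥ v) ≤ v ⬝ᵥ ((A + R • 1) ^ k *ᵥ v) := by
  have hR : 0 ≤ R := le_trans (dotProduct_self_nonneg v) hv
  have ha : ∀ i j : ℕ, (v ⬝ᵥ (A ^ i *ᵥ v)) * (v ⬝ᵥ (A ^ j *ᵥ v))
      ≤ R * (v ⬝ᵥ (A ^ (i + j) *ᵥ v)) := fun i j =>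
    (moment_mul_moment_le hA v i j).trans
      (mul_le_mul_of_nonneg_right hv (dotProduct_pow_mulVec_nonneg hA v _))
  have hg : ∀ p k : ℕ, v ⬝ᵥ ((A ^ p * (A + R • 1) ^ (k + 1)) *ᵥ v)
      = v ⬝ᵥ ((A ^ (p + 1) * (A + R • 1) ^ k) *ᵥ v)
        + R * (v ⬝ᵥ ((A ^ p * (A + R • 1) ^ k) *ᵥ v)) := by
    intro p k
    rw [pow_succ' (A + R • 1), ← Matrix.mul_assoc, Matrix.mul_add, ← pow_succ, Matrix.add_mul,
      add_mulVec, dotProduct_add]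
    simp [smul_mulVec]
  have hf : ∀ p k : ℕ, v ⬝ᵥ ((A ^ p * (A + vecMulVec v v) ^ (k + 1)) *ᵥ v)
      = v ⬝ᵥ ((A ^ (p + 1) * (A + vecMulVec v v) ^ k) *ᵥ v)
        + (v ⬝ᵥ (A ^ p *ᵥ v)) * (v ⬝ᵥ ((A + vecMulVec v v) ^ k *ᵥ v)) := by
    intro p k
    rw [pow_succ' (A + vecMulVec v v), ← Matrix.mul_assoc, Matrix.mul_add, ← pow_succ,
      Matrix.add_mul, add_mulVec, dotProduct_add]
    congr 1
    rw [mul_vecMulVec, vecMulVec_mul, vecMulVec_mulVec, ← dotProduct_mulVec]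
    simp [mul_comm]
  -- The correlation inequality `ha` survives multiplication by `(A + R • 1) ^ k`, whose expansion
  -- in powers of `A` has nonnegative coefficients.
  have hcorr : ∀ k i j : ℕ, (v ⬝ᵥ (A ^ i *ᵥ v)) * (v ⬝ᵥ ((A ^ j * (A + R • 1) ^ k) *ᵥ v))
      ≤ R * (v ⬝ᵥ ((A ^ (i + j) * (A + R • 1) ^ k) *ᵥ v)) := by
    intro k
    induction k with
    | zero => intro i j; simpa using ha i j
    | succ k ih =>
      intro i j
      rw [hg, hg]
      have h1 := ih i (j + 1)
      have h2 := mul_le_mul_of_nonneg_left (ih i j) hR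
      rw [← add_assoc] at h1
      nlinarith
  -- The extra factor `A ^ p` is needed for the induction: splitting off one factor raises the power
  -- of `A`.
  have main : ∀ k p : ℕ, v ⬝ᵥ ((A ^ p * (A + vecMulVec v v) ^ k) *ᵥ v)
      ≤ v ⬝ᵥ ((A ^ p * (A + R • 1) ^ k) *ᵥ v) := by
    intro k
    induction k with
    | zero => intro p; simp
    | succ k ih =>
      intro p
      rw [hf, hg]
      refine add_le_add (ih (p + 1)) ?_
      have h0 := ih 0
      have h1 := hcorr k p 0
      simp only [pow_zero, Matrix.one_mul, add_zero] at h0 h1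
      exact (mul_le_mul_of_nonneg_left h0 (dotProduct_pow_mulVec_nonneg hA v p)).trans h1
  simpa using main k 0

/-- Iterating the correlation inequality gives the power-mean bound `(xᵀAx)^q ≤ |x|^{2(q-1)} xᵀA^q
x`; then every spectral weight `(u s ⬝ᵥ x) ^ 2` is at most `|x|²`. This lets `(tr A^q)^{1/q}` stand
in for the largest eigenvalue. -/
lemma dotProduct_mulVec_pow_le_trace {A : Matrix n n ℝ} (hA : A.PosSemidef) (x : n → ℝ) {q : ℕ}
    (hq0 : q ≠ 0) : (x ⬝ᵥ (A *ᵥ x)) ^ q ≤ (x ⬝ᵥ x) ^ q * (A ^ q).trace := by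
  obtain ⟨u, l, hl, hu, h0, hq, ht⟩ := exists_spectral_moments hA
  have hx0 : 0 ≤ x ⬝ᵥ x := dotProduct_self_nonneg x
  have h1 : ∀ r : ℕ, (x ⬝ᵥ (A *ᵥ x)) ^ (r + 1) ≤ (x ⬝ᵥ x) ^ r * (x ⬝ᵥ (A ^ (r + 1) *ᵥ x)) := by
    intro r
    induction r with
    | zero => simp
    | succ r ih =>
      have hA1 : 0 ≤ x ⬝ᵥ (A *ᵥ x) := by simpa using dotProduct_pow_mulVec_nonneg hA x 1
      have := moment_mul_moment_le hA x (r + 1) 1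
      rw [pow_one] at this
      calc (x ⬝ᵥ (A *ᵥ x)) ^ (r + 1 + 1) = (x ⬝ᵥ (A *ᵥ x)) ^ (r + 1) * (x ⬝ᵥ (A *ᵥ x)) :=
            pow_succ _ _
        _ ≤ (x ⬝ᵥ x) ^ r * (x ⬝ᵥ (A ^ (r + 1) *ᵥ x)) * (x ⬝ᵥ (A *ᵥ x)) :=
            mul_le_mul_of_nonneg_right ih hA1
        _ = (x ⬝ᵥ x) ^ r * ((x ⬝ᵥ (A ^ (r + 1) *ᵥ x)) * (x ⬝ᵥ (A *ᵥ x))) := by ring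
        _ ≤ (x ⬝ᵥ x) ^ r * ((x ⬝ᵥ x) * (x ⬝ᵥ (A ^ (r + 1 + 1) *ᵥ x))) :=
            mul_le_mul_of_nonneg_left this (pow_nonneg hx0 _)
        _ = _ := by ring
  obtain ⟨r, rfl⟩ : ∃ r, q = r + 1 := ⟨q - 1, by omega⟩
  refine (h1 r).trans ?_
  rw [pow_succ (x ⬝ᵥ x), mul_assoc]
  refine mul_le_mul_of_nonneg_left ?_ (pow_nonneg hx0 _)
  rw [hq, ht, mul_sum]
  refine sum_le_sum fun s _ => ?_
  rw [mul_comm]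
  refine mul_le_mul_of_nonneg_right ?_ (pow_nonneg (hl s) _)
  rw [← h0]
  exact single_le_sum (f := fun s => (u s ⬝ᵥ x) ^ 2) (fun _ _ => sq_nonneg _) (mem_univ s)

/-- `tr (M P) ≤ λ tr P` for a power `P` of a positive semidefinite matrix and `M = ∑ vᵢ vᵢᵀ ≤ λ`. -/
lemma sum_moment_le_trace {ι : Type*} {A : Matrix n n ℝ} (hA : A.PosSemidef) (s : Finset ι)
    (v : ι → n → ℝ) {lam : ℝ} (hlam : ∀ x, ∑ i ∈ s, (v i ⬝ᵥ x) ^ 2 ≤ lam * (x ⬝ᵥ x)) (k : ℕ) :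
    ∑ i ∈ s, v i ⬝ᵥ (A ^ k *ᵥ v i) ≤ lam * (A ^ k).trace := by
  obtain ⟨u, l, hl, hu, -, hq, ht⟩ := exists_spectral_moments hA
  simp only [hq, ht]
  rw [sum_comm, mul_sum]
  refine sum_le_sum fun t _ => ?_
  rw [← mul_sum, mul_comm lam]
  refine mul_le_mul_of_nonneg_left ?_ (pow_nonneg (hl t) _)
  have := hlam (u t)
  rw [hu, mul_one] at this
  simpa only [dotProduct_comm (u t)] using this

end SpectralMoments

/-! ### Leave-one-out reindexing of sums over subsets. -/

section SubsetSums

variable {ι : Type*} [DecidableEq ι]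

/-- The pairs `i ∈ I` correspond to the pairs `i ∉ J` by `J = I.erase i`. Both the moment recursion
and the union bound use this. -/
lemma sum_powersetCard_succ_sum_erase (s : Finset ι) (k : ℕ) (F : ι → Finset ι → ℝ) :
    ∑ I ∈ s.powersetCard (k + 1), ∑ i ∈ I, F i (I.erase i)
      = ∑ J ∈ s.powersetCard k, ∑ i ∈ s \ J, F i J := by
  rw [sum_sigma', sum_sigma']
  refine sum_bij' (fun p _ => ⟨p.1.erase p.2, p.2⟩) (fun p _ => ⟨insert p.2 p.1, p.2⟩)
    ?_ ?_ ?_ ?_ ?_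
  · rintro ⟨I, i⟩ h
    simp only [mem_sigma, mem_powersetCard, mem_sdiff, mem_erase] at h ⊢
    obtain ⟨⟨hI, hc⟩, hi⟩ := h
    exact ⟨⟨(erase_subset _ _).trans hI, by rw [card_erase_of_mem hi, hc]; rfl⟩, hI hi, by simp⟩
  · rintro ⟨J, i⟩ h
    simp only [mem_sigma, mem_powersetCard, mem_sdiff] at h ⊢
    obtain ⟨⟨hJ, hc⟩, hi, hiJ⟩ := h
    exact ⟨⟨insert_subset hi hJ, by rw [card_insert_of_notMem hiJ, hc]⟩, mem_insert_self _ _⟩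
  · rintro ⟨I, i⟩ h
    simp only [mem_sigma] at h
    simp [insert_erase h.2]
  · rintro ⟨J, i⟩ h
    simp only [mem_sigma, mem_sdiff] at h
    simp [erase_insert h.2.2]
  · rintro ⟨I, i⟩ _
    rfl

end SubsetSums

/-- This closes the moment recursion. From `R ≤ K / (p + 1)` one gets `(K + R)^p ≤ e K^p`, and for
`p ≥ 2` also `R^p ≤ K^p / 9`; the total `2/27 + e/3` is below `1`. The cases `p = 0, 1` are direct.
-/
lemma two_thirds_pow_add_le {R K : ℝ} {p q : ℕ} (hR : 0 ≤ R) (hK : q * R ≤ K) (hpq : p + 1 ≤ q) :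
    2 / 3 * R ^ p + 1 / 3 * (K + R) ^ p ≤ K ^ p := by
  have hpq' : ((p : ℝ) + 1) * R ≤ K :=
    le_trans (mul_le_mul_of_nonneg_right (by exact_mod_cast hpq) hR) hK
  have hK0 : 0 ≤ K := le_trans (by positivity) hpq'
  rcases p with _ | _ | p
  · norm_num
  · norm_num at hpq' ⊢; linarith
  · set r := p + 2 with hr
    have hr2 : (2 : ℝ) ≤ r := by rw [hr]; push_cast; linarith [Nat.cast_nonneg (α := ℝ) p]
    have e1 : R ^ r ≤ K ^ r / 9 := by
      have h3 : R ≤ K / 3 := by push_cast [hr] at hpq'; nlinarith [Nat.cast_nonneg (α := ℝ) p]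
      calc R ^ r ≤ (K / 3) ^ r := pow_le_pow_left₀ hR h3 _
        _ = K ^ r / 3 ^ r := div_pow _ _ _
        _ ≤ K ^ r / 9 := by
          refine div_le_div_of_nonneg_left (by positivity) (by norm_num) ?_
          calc (9 : ℝ) = 3 ^ 2 := by norm_num
            _ ≤ 3 ^ r := pow_le_pow_right₀ (by norm_num) (by omega)
    have e2 : (K + R) ^ r ≤ K ^ r * 2.7182818286 := by
      have h4 : R ≤ K / ((r : ℝ) + 1) := by
        rw [le_div_iff₀ (by positivity)]; linarith
      calc (K + R) ^ r ≤ (K * (1 / ((r : ℝ) + 1) + 1)) ^ r := by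
            refine pow_le_pow_left₀ (by positivity) ?_ _
            have : K * (1 / ((r : ℝ) + 1) + 1) = K / ((r : ℝ) + 1) + K := by ring
            linarith
        _ = K ^ r * (1 / ((r : ℝ) + 1) + 1) ^ r := mul_pow _ _ _
        _ ≤ K ^ r * Real.exp (1 / ((r : ℝ) + 1)) ^ r := by
            gcongr; exact Real.add_one_le_exp _
        _ = K ^ r * Real.exp (r * (1 / ((r : ℝ) + 1))) := by rw [← Real.exp_nat_mul]
        _ ≤ K ^ r * Real.exp 1 := by
            gcongr
            rw [mul_one_div, div_le_one (by positivity)]; linarith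
        _ ≤ _ := by
            refine mul_le_mul_of_nonneg_left Real.exp_one_lt_d9.le (by positivity)
    have : 0 ≤ K ^ r := by positivity
    nlinarith

/-! ### Trace moments of sums of rank-one matrices over random subsets. -/

section RankOneSums

variable {ι n : Type*} [Fintype n]

/-- The sum of the rank-one matrices `vᵢ vᵢᵀ` over `i ∈ J`. -/
def rankOneSum (v : ι → n → ℝ) (J : Finset ι) : Matrix n n ℝ :=
  ∑ i ∈ J, vecMulVec (v i) (v i)

lemma rankOneSum_posSemidef (v : ι → n → ℝ) (J : Finset ι) : (rankOneSum v J).PosSemidef :=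
  posSemidef_sum _ fun i _ => by simpa using posSemidef_vecMulVec_self_star (v i)

lemma dotProduct_rankOneSum_mulVec (v : ι → n → ℝ) (J : Finset ι) (x : n → ℝ) :
    x ⬝ᵥ (rankOneSum v J *ᵥ x) = ∑ i ∈ J, (v i ⬝ᵥ x) ^ 2 := by
  rw [rankOneSum, sum_mulVec, dotProduct_sum]
  refine sum_congr rfl fun i _ => ?_
  rw [vecMulVec_mulVec]
  simp [dotProduct_comm x, sq]

variable [DecidableEq n]

lemma trace_rankOneSum_pow_succ (v : ι → n → ℝ) (J : Finset ι) (k : ℕ) :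
    (rankOneSum v J ^ (k + 1)).trace = ∑ i ∈ J, v i ⬝ᵥ (rankOneSum v J ^ k *ᵥ v i) := by
  rw [pow_succ]
  nth_rewrite 2 [rankOneSum]
  rw [Matrix.mul_sum, trace_sum]
  refine sum_congr rfl fun i _ => ?_
  rw [mul_vecMulVec, trace_vecMulVec, dotProduct_comm]

/-- Binomial expansion, then `sum_moment_le_trace` in each positive degree. Degree `0` is kept as `∑
|vᵢ|²`, since the trace bound would bring in the dimension of the ambient space. -/
lemma sum_moment_add_smul_one_le {A : Matrix n n ℝ} (hA : A.PosSemidef) (s : Finset ι)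
    (v : ι → n → ℝ) {R lam : ℝ} (hR : 0 ≤ R)
    (hlam : ∀ x, ∑ i ∈ s, (v i ⬝ᵥ x) ^ 2 ≤ lam * (x ⬝ᵥ x)) (p : ℕ) :
    ∑ i ∈ s, v i ⬝ᵥ ((A + R • 1) ^ p *ᵥ v i) ≤ R ^ p * ∑ i ∈ s, v i ⬝ᵥ v i
      + lam * ∑ j ∈ range p, R ^ (p - (j + 1)) * (p.choose (j + 1)) * (A ^ (j + 1)).trace := by
  have hexp : (A + R • 1) ^ p = ∑ j ∈ range (p + 1), (R ^ (p - j) * (p.choose j : ℝ)) • A ^ j := by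
    have hc : Commute A (R • (1 : Matrix n n ℝ)) := (Commute.one_right A).smul_right R
    rw [hc.add_pow]
    refine sum_congr rfl fun j _ => ?_
    rw [smul_pow, one_pow, mul_smul_comm, mul_one, ← nsmul_eq_mul', mul_smul, smul_comm,
      Nat.cast_smul_eq_nsmul]
  have h1 : ∀ i, v i ⬝ᵥ ((A + R • 1) ^ p *ᵥ v i)
      = ∑ j ∈ range (p + 1), (R ^ (p - j) * (p.choose j : ℝ)) * (v i ⬝ᵥ (A ^ j *ᵥ v i)) := by
    intro i
    rw [hexp, sum_mulVec, dotProduct_sum]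
    refine sum_congr rfl fun j _ => ?_
    rw [smul_mulVec, dotProduct_smul, smul_eq_mul]
  simp only [h1]
  rw [sum_comm, sum_range_succ', add_comm, mul_sum _ _ lam]
  refine add_le_add (by simp [mul_sum]) (sum_le_sum fun j _ => ?_)
  rw [← mul_sum]
  have := mul_le_mul_of_nonneg_left (sum_moment_le_trace hA s v hlam (j + 1))
    (show 0 ≤ R ^ (p - (j + 1)) * (p.choose (j + 1) : ℝ) by positivity)
  linarith

variable [DecidableEq ι]

/-- One summand `vᵢvᵢᵀ` is traded for `R • 1`, which makes the remaining matrix depend on `I.erase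
i` only. By positivity `i` may then run over all of `s` instead of `s \ J`. -/
lemma sum_trace_rankOneSum_pow_succ_le (s : Finset ι) (v : ι → n → ℝ) {R : ℝ}
    (hv : ∀ i ∈ s, v i ⬝ᵥ v i ≤ R) (k p : ℕ) :
    ∑ I ∈ s.powersetCard (k + 1), (rankOneSum v I ^ (p + 1)).trace
      ≤ ∑ J ∈ s.powersetCard k, ∑ i ∈ s, v i ⬝ᵥ ((rankOneSum v J + R • 1) ^ p *ᵥ v i) := by
  have step : ∀ I ∈ s.powersetCard (k + 1), (rankOneSum v I ^ (p + 1)).trace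
      ≤ ∑ i ∈ I, v i ⬝ᵥ ((rankOneSum v (I.erase i) + R • 1) ^ p *ᵥ v i) := by
    intro I hI
    rw [trace_rankOneSum_pow_succ]
    refine sum_le_sum fun i hi => ?_
    have : rankOneSum v I = rankOneSum v (I.erase i) + vecMulVec (v i) (v i) := by
      rw [rankOneSum, rankOneSum, sum_erase_add _ _ hi]
    rw [this]
    exact moment_add_vecMulVec_le (rankOneSum_posSemidef _ _)
      (hv i ((mem_powersetCard.1 hI).1 hi)) p
  refine (sum_le_sum step).trans ?_
  rw [sum_powersetCard_succ_sum_erase s k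
    (fun i J => v i ⬝ᵥ ((rankOneSum v J + R • 1) ^ p *ᵥ v i))]
  refine sum_le_sum fun J _ => sum_le_sum_of_subset_of_nonneg sdiff_subset fun i hi _ => ?_
  have hR : 0 ≤ R := le_trans (dotProduct_self_nonneg (v i)) (hv i hi)
  exact dotProduct_pow_mulVec_nonneg
    ((rankOneSum_posSemidef v J).add (PosSemidef.one.smul hR)) _ _

/-- Moment bound for sums of rank-one matrices over uniformly random subsets. -/
lemma sum_trace_rankOneSum_pow_le (s : Finset ι) (v : ι → n → ℝ) {R lam ρ K D : ℝ} {q k : ℕ}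
    (hR : 0 ≤ R) (hρ : 0 ≤ ρ) (hD : 0 ≤ D) (hv : ∀ i ∈ s, v i ⬝ᵥ v i ≤ R)
    (hlam : ∀ x, ∑ i ∈ s, (v i ⬝ᵥ x) ^ 2 ≤ lam * (x ⬝ᵥ x)) (hlam0 : 0 ≤ lam)
    (hk : k ≤ #s) (hkρ : (k : ℝ) ≤ ρ * ((#s : ℝ) - k + 1))
    (hRK : q * R ≤ K) (hlamK : 3 * (ρ * lam) ≤ K) (hDK : ρ * ∑ i ∈ s, v i ⬝ᵥ v i ≤ D * K)
    (hq : q ≠ 0) :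
    ∑ I ∈ s.powersetCard k, (rankOneSum v I ^ q).trace ≤ (#s).choose k * (D * K ^ q) := by
  have hK0 : 0 ≤ K := le_trans (by positivity) hRK
  -- All sizes `k' ≤ k` are treated together, because the recursion lowers the size of the subset
  -- along with the exponent.
  have main : ∀ p : ℕ, p + 1 ≤ q → ∀ k' ≤ k,
      ∑ I ∈ s.powersetCard k', (rankOneSum v I ^ (p + 1)).trace
        ≤ (#s).choose k' * (D * K ^ (p + 1)) := by
    intro p
    induction p using Nat.strong_induction_on with
    | _ p ih =>
      intro hpq k' hk'
      rcases k' with _ | k'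
      · simp [rankOneSum]; positivity
      refine (sum_trace_rankOneSum_pow_succ_le s v hv k' p).trans ?_
      refine (sum_le_sum fun J _ => sum_moment_add_smul_one_le (rankOneSum_posSemidef v J) s v hR
        hlam p).trans ?_
      rw [sum_add_distrib, sum_const, card_powersetCard, nsmul_eq_mul, ← mul_sum, sum_comm]
      have h1 : ∑ j ∈ range p, ∑ J ∈ s.powersetCard k',
          R ^ (p - (j + 1)) * (p.choose (j + 1)) * (rankOneSum v J ^ (j + 1)).trace
          ≤ (#s).choose k' * (D * ((K + R) ^ p - R ^ p)) := by
        have hbin : (K + R) ^ p - R ^ p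
            = ∑ j ∈ range p, R ^ (p - (j + 1)) * (p.choose (j + 1)) * K ^ (j + 1) := by
          rw [add_pow, sum_range_succ']
          simp only [pow_zero, Nat.choose_zero_right, Nat.cast_one, one_mul, mul_one, Nat.sub_zero,
            add_sub_cancel_right]
          exact sum_congr rfl fun j _ => by ring
        rw [hbin, mul_sum, mul_sum]
        refine sum_le_sum fun j hj => ?_
        rw [← mul_sum]
        have := mul_le_mul_of_nonneg_left
          (ih j (mem_range.1 hj) (by have := mem_range.1 hj; omega) k' (by omega))
          (show 0 ≤ R ^ (p - (j + 1)) * (p.choose (j + 1) : ℝ) by positivity)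
        linarith
      -- The ratio of the two binomial coefficients is `(k' + 1) / (#s - k')`; this is where `ρ`
      -- enters.
      have hch : ((#s).choose k' : ℝ) ≤ ρ * (#s).choose (k' + 1) := by
        have e : ((#s).choose (k' + 1) : ℝ) * (k' + 1) = (#s).choose k' * ((#s : ℝ) - k') := by
          have := Nat.choose_succ_right_eq (#s) k'
          have h2 := congrArg (Nat.cast : ℕ → ℝ) this
          push_cast [Nat.cast_sub (show k' ≤ #s by omega)] at h2
          exact h2
        have hpos : (0 : ℝ) < (#s : ℝ) - k' := by
          have : k' + 1 ≤ #s := by omega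
          have : (k' : ℝ) + 1 ≤ #s := by exact_mod_cast this
          linarith
        have hk'' : (k' : ℝ) + 1 ≤ k := by exact_mod_cast hk'
        have hle : (k' : ℝ) + 1 ≤ ρ * ((#s : ℝ) - k') := by
          have : ρ * ((#s : ℝ) - k + 1) ≤ ρ * ((#s : ℝ) - k') :=
            mul_le_mul_of_nonneg_left (by linarith) hρ
          linarith
        have hc0 : (0 : ℝ) ≤ (#s).choose (k' + 1) := Nat.cast_nonneg _
        have := mul_le_mul_of_nonneg_left hle hc0
        refine le_of_mul_le_mul_right ?_ hpos
        nlinarith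
      have hW : 0 ≤ ∑ i ∈ s, v i ⬝ᵥ v i := sum_nonneg fun i _ => dotProduct_self_nonneg _
      have hdiff : 0 ≤ (K + R) ^ p - R ^ p :=
        sub_nonneg.2 (pow_le_pow_left₀ hR (by linarith) _)
      set W := ∑ i ∈ s, v i ⬝ᵥ v i with hWdef
      set C : ℝ := ((#s).choose (k' + 1) : ℝ) with hC
      have hC0 : 0 ≤ C := Nat.cast_nonneg _
      calc (#s).choose k' * (R ^ p * W) + lam * _
          ≤ (#s).choose k' * (R ^ p * W) + lam * ((#s).choose k' * (D * ((K + R) ^ p - R ^ p))) :=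
            add_le_add le_rfl (mul_le_mul_of_nonneg_left h1 hlam0)
        _ = (#s).choose k' * (R ^ p * W + lam * (D * ((K + R) ^ p - R ^ p))) := by ring
        _ ≤ ρ * C * (R ^ p * W + lam * (D * ((K + R) ^ p - R ^ p))) := by
            gcongr
        _ = C * (R ^ p * (ρ * W) + (ρ * lam) * (D * ((K + R) ^ p - R ^ p))) := by ring
        _ ≤ C * (R ^ p * (D * K) + (K / 3) * (D * ((K + R) ^ p - R ^ p))) := by
            have : ρ * lam ≤ K / 3 := by linarith
            gcongr
        _ = C * (D * K * (2 / 3 * R ^ p + 1 / 3 * (K + R) ^ p)) := by ring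
        _ ≤ C * (D * K * K ^ p) := by
            have := two_thirds_pow_add_le hR hRK hpq
            gcongr
        _ = C * (D * K ^ (p + 1)) := by ring
  obtain ⟨p, rfl⟩ := Nat.exists_eq_succ_of_ne_zero hq
  exact main p le_rfl k le_rfl

end RankOneSums

/-! ### Exponential moments and tails for sampling without replacement. -/

section Tail

variable {ι : Type*} [DecidableEq ι]

/-- A fixed `t`-set lies in a random `k`-subset with probability `∏ (k - i) / (n - i)` over `i < t`,
and each factor is at most `k / n`. -/
lemma choose_sub_mul_pow_le {n k : ℕ} (hkn : k ≤ n) :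
    ∀ t ≤ k, (n - t).choose (k - t) * n ^ t ≤ n.choose k * k ^ t := by
  intro t
  induction t with
  | zero => intro _; simp
  | succ t ih =>
    intro ht
    have hstep : (n - (t + 1)).choose (k - (t + 1)) * n ≤ (n - t).choose (k - t) * k := by
      obtain ⟨k', hk'⟩ : ∃ k', k = t + 1 + k' := ⟨k - (t + 1), by omega⟩
      obtain ⟨n', hn'⟩ : ∃ n', n = t + 1 + n' := ⟨n - (t + 1), by omega⟩
      have e1 : n - (t + 1) = n' := by omega
      have e2 : k - (t + 1) = k' := by omega
      have e3 : n - t = n' + 1 := by omega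
      have e4 : k - t = k' + 1 := by omega
      rw [e1, e2, e3, e4]
      have h := Nat.add_one_mul_choose_eq n' k'
      have hle : (k' + 1) * n ≤ k * (n' + 1) := by
        have : k' ≤ n' := by omega
        rw [hk', hn']; nlinarith
      refine Nat.le_of_mul_le_mul_left ?_ (Nat.add_one_pos n')
      calc (n' + 1) * (n'.choose k' * n) = (n' + 1) * n'.choose k' * n := by ring
        _ = (n' + 1).choose (k' + 1) * ((k' + 1) * n) := by rw [h]; ring
        _ ≤ (n' + 1).choose (k' + 1) * (k * (n' + 1)) := Nat.mul_le_mul_left _ hle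
        _ = _ := by ring
    calc (n - (t + 1)).choose (k - (t + 1)) * n ^ (t + 1)
        = ((n - (t + 1)).choose (k - (t + 1)) * n) * n ^ t := by ring
      _ ≤ ((n - t).choose (k - t) * k) * n ^ t := Nat.mul_le_mul_right _ hstep
      _ = ((n - t).choose (k - t) * n ^ t) * k := by ring
      _ ≤ (n.choose k * k ^ t) * k := Nat.mul_le_mul_right _ (ih (by omega))
      _ = _ := by ring

/-- Sampling without replacement is dominated by independent sampling, for products of factors
that are at least `1`. -/
lemma sum_powersetCard_prod_one_add_le (s : Finset ι) {k : ℕ} (hk : k ≤ #s) (z : ι → ℝ)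
    (hz : ∀ i ∈ s, 0 ≤ z i) :
    ∑ J ∈ s.powersetCard k, ∏ i ∈ J, (1 + z i)
      ≤ (#s).choose k * Real.exp ((k : ℝ) / #s * ∑ i ∈ s, z i) := by
  rcases s.eq_empty_or_nonempty with rfl | hs
  · simp at hk; subst hk; simp
  have hs0 : (0 : ℝ) < #s := by exact_mod_cast hs.card_pos
  simp only [prod_one_add]
  rw [sum_comm' (t' := s.powerset) (s' := fun T => (s.powersetCard k).filter (T ⊆ ·))]
  swap
  · intro J T
    simp only [mem_powersetCard, mem_powerset, mem_filter]
    exact ⟨fun h => ⟨⟨h.1, h.2⟩, h.2.trans h.1.1⟩, fun h => ⟨h.1.1, h.1.2⟩⟩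
  have hcount : ∀ T ∈ s.powerset, ∑ J ∈ (s.powersetCard k).filter (T ⊆ ·), ∏ i ∈ T, z i
      ≤ (#s).choose k * ∏ i ∈ T, ((k : ℝ) / #s * z i) := by
    intro T hT
    have hTs := mem_powerset.1 hT
    rw [sum_const, nsmul_eq_mul, prod_mul_distrib, prod_const, ← mul_assoc]
    refine mul_le_mul_of_nonneg_right ?_ (prod_nonneg fun i hi => hz i (hTs hi))
    rcases le_or_gt (#T) k with hTk | hTk
    · rw [card_filter_powersetCard_subset _ _ _ hTs hTk, div_pow, ← mul_div_assoc,
        le_div_iff₀ (by positivity)]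
      exact_mod_cast choose_sub_mul_pow_le hk _ hTk
    · rw [filter_eq_empty_iff.2]
      · simp only [card_empty, Nat.cast_zero]; positivity
      · intro J hJ hTJ
        have := card_le_card hTJ
        rw [(mem_powersetCard.1 hJ).2] at this
        omega
  refine (sum_le_sum hcount).trans ?_
  rw [← mul_sum, ← prod_one_add, mul_sum, Real.exp_sum]
  refine mul_le_mul_of_nonneg_left ?_ (Nat.cast_nonneg _)
  refine prod_le_prod (fun i hi => ?_) fun i hi => ?_
  · have := hz i hi; positivity
  · rw [add_comm]; exact Real.add_one_le_exp _

/-- Subgaussian tail of the sum over a uniformly random `k`-subset of numbers in `[0, M]`. -/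
lemma card_filter_sum_ge_le (s : Finset ι) {k : ℕ} (hk : k ≤ #s) (x : ι → ℝ) {M avg t E : ℝ}
    (hx0 : ∀ i ∈ s, 0 ≤ x i) (hxM : ∀ i ∈ s, x i ≤ M) (hM : 0 ≤ M) (ht : 0 < t)
    (havg : (k : ℝ) / #s * ∑ i ∈ s, x i ≤ avg) (hE : 4 * (k * M ^ 2) * E ≤ t ^ 2) :
    (#((s.powersetCard k).filter fun J => avg + t ≤ ∑ i ∈ J, x i) : ℝ)
      ≤ (#s).choose k * Real.exp (-E) := by
  have havg0 : 0 ≤ avg := le_trans (mul_nonneg (by positivity) (sum_nonneg hx0)) havg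
  -- If `t > 2kM` the event is empty, as the sum is at most `kM`. Otherwise the optimal `θ = t /
  -- (2kM²)` satisfies `θM ≤ 1`, so `e^y ≤ 1 + y + y²` applies to `y = θ * x i`.
  rcases lt_or_ge (2 * (k * M)) t with h | h
  · rw [filter_eq_empty_iff.2]
    · simp only [card_empty, Nat.cast_zero]; positivity
    · intro J hJ hle
      obtain ⟨hJs, hJk⟩ := mem_powersetCard.1 hJ
      have h1 : ∑ i ∈ J, x i ≤ k * M := by
        refine (sum_le_card_nsmul J x M fun i hi => hxM i (hJs hi)).trans ?_
        rw [hJk, nsmul_eq_mul]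
      have : 0 ≤ (k : ℝ) * M := by positivity
      linarith
  have hkM : 0 < (k : ℝ) * M := by linarith
  have hM0 : 0 < M := pos_of_mul_pos_right hkM (Nat.cast_nonneg k)
  have hk0 : 0 < (k : ℝ) := pos_of_mul_pos_left hkM hM
  have hs0 : (0 : ℝ) < #s := lt_of_lt_of_le hk0 (by exact_mod_cast hk)
  set θ : ℝ := t / (2 * (k * M ^ 2)) with hθ
  have hθ0 : 0 < θ := by positivity
  have hθM : θ * M ≤ 1 := by
    rw [hθ, div_mul_eq_mul_div, div_le_one (by positivity)]
    nlinarith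
  set z : ι → ℝ := fun i => Real.exp (θ * x i) - 1 with hzdef
  have hz0 : ∀ i ∈ s, 0 ≤ z i := fun i hi =>
    sub_nonneg.2 (Real.one_le_exp (mul_nonneg hθ0.le (hx0 i hi)))
  have hz : ∀ i ∈ s, z i ≤ θ * x i + θ ^ 2 * M ^ 2 := by
    intro i hi
    have h0 : 0 ≤ θ * x i := mul_nonneg hθ0.le (hx0 i hi)
    have h1 : θ * x i ≤ θ * M := mul_le_mul_of_nonneg_left (hxM i hi) hθ0.le
    have h2 := Real.abs_exp_sub_one_sub_id_le (x := θ * x i)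
      (by rw [abs_of_nonneg h0]; linarith)
    have h3 := (abs_le.1 h2).2
    have h4 : (θ * x i) ^ 2 ≤ (θ * M) ^ 2 := pow_le_pow_left₀ h0 h1 2
    have h5 : (θ * M) ^ 2 = θ ^ 2 * M ^ 2 := mul_pow _ _ _
    simp only [hzdef]; linarith
  have hsum : (k : ℝ) / #s * ∑ i ∈ s, z i ≤ θ * avg + θ ^ 2 * (k * M ^ 2) := by
    calc (k : ℝ) / #s * ∑ i ∈ s, z i
        ≤ (k : ℝ) / #s * ∑ i ∈ s, (θ * x i + θ ^ 2 * M ^ 2) := by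
          gcongr with i hi; exact hz i hi
      _ = θ * ((k : ℝ) / #s * ∑ i ∈ s, x i) + θ ^ 2 * (k * M ^ 2) := by
          rw [sum_add_distrib, ← mul_sum, sum_const, nsmul_eq_mul]; field_simp
      _ ≤ _ := by gcongr
  have hmgf := sum_powersetCard_prod_one_add_le s hk z hz0
  have hprod : ∀ J : Finset ι, ∏ i ∈ J, (1 + z i) = Real.exp (θ * ∑ i ∈ J, x i) := by
    intro J
    rw [mul_sum, Real.exp_sum]
    exact prod_congr rfl fun i _ => by simp [hzdef]
  simp only [hprod] at hmgf
  have hmarkov : (#((s.powersetCard k).filter fun J => avg + t ≤ ∑ i ∈ J, x i) : ℝ)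
      * Real.exp (θ * (avg + t)) ≤ ∑ J ∈ s.powersetCard k, Real.exp (θ * ∑ i ∈ J, x i) := by
    rw [← nsmul_eq_mul]
    refine (card_nsmul_le_sum _ _ _ fun J hJ => ?_).trans
      (sum_le_sum_of_subset_of_nonneg (filter_subset _ _) fun _ _ _ => (Real.exp_pos _).le)
    exact Real.exp_le_exp.2 (mul_le_mul_of_nonneg_left (mem_filter.1 hJ).2 hθ0.le)
  have hfin : (#s).choose k * Real.exp ((k : ℝ) / #s * ∑ i ∈ s, z i)
      ≤ (#s).choose k * Real.exp (-E) * Real.exp (θ * (avg + t)) := by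
    rw [mul_assoc, ← Real.exp_add]
    refine mul_le_mul_of_nonneg_left (Real.exp_le_exp.2 ?_) (Nat.cast_nonneg _)
    -- At this `θ` the exponent `θt - θ²kM²` equals `t² / (4kM²)`.
    have e1 : θ * (2 * (k * M ^ 2)) = t := by rw [hθ]; field_simp
    have e2 : E ≤ θ * t - θ ^ 2 * (k * M ^ 2) := by
      have hpos : 0 < 4 * (k * M ^ 2) := by positivity
      refine le_of_mul_le_mul_left (hE.trans (le_of_eq ?_)) hpos
      rw [← e1]; ring
    linarith
  exact le_of_mul_le_mul_right (hmarkov.trans (hmgf.trans hfin)) (Real.exp_pos _)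

/-- Union bound: a uniformly random `(k+1)`-subset `I` of a finite type rarely contains an index
`j` such that the sum of `x i j` over the other `i ∈ I` is large. -/
lemma card_filter_exists_sum_erase_ge_le [Fintype ι] {k : ℕ} (hk : k + 1 ≤ Fintype.card ι)
    (x : ι → ι → ℝ) {M avg t E : ℝ} (hx0 : ∀ i j, 0 ≤ x i j) (hxM : ∀ i j, i ≠ j → x i j ≤ M)
    (hM : 0 ≤ M) (ht : 0 < t)
    (havg : ∀ j, (k : ℝ) / ((Fintype.card ι : ℝ) - 1) * ∑ i ∈ univ.erase j, x i j ≤ avg)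
    (hE : 4 * (k * M ^ 2) * E ≤ t ^ 2) :
    (#((univ.powersetCard (k + 1)).filter
        fun I : Finset ι => ∃ j ∈ I, avg + t ≤ ∑ i ∈ I.erase j, x i j) : ℝ)
      ≤ (k + 1) * (Fintype.card ι).choose (k + 1) * Real.exp (-E) := by
  classical
  set F : ι → Finset ι → ℝ := fun j J => if avg + t ≤ ∑ i ∈ J, x i j then 1 else 0 with hF
  have hF0 : ∀ j J, 0 ≤ F j J := fun j J => by simp only [hF]; split_ifs <;> norm_num
  have h1 : (#((univ.powersetCard (k + 1)).filter
        fun I : Finset ι => ∃ j ∈ I, avg + t ≤ ∑ i ∈ I.erase j, x i j) : ℝ)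
      ≤ ∑ I ∈ (univ : Finset ι).powersetCard (k + 1), ∑ j ∈ I, F j (I.erase j) := by
    rw [card_filter]
    push_cast
    refine sum_le_sum fun I _ => ?_
    split_ifs with h
    · obtain ⟨j, hj, hle⟩ := h
      refine le_trans (le_of_eq ?_)
        (single_le_sum (f := fun j => F j (I.erase j)) (fun j _ => hF0 j _) hj)
      simp only [hF, if_pos hle]
    · exact sum_nonneg fun j _ => hF0 j _
  refine h1.trans ?_
  rw [sum_powersetCard_succ_sum_erase, sum_comm' (t' := univ)
    (s' := fun j => (univ.erase j).powersetCard k)]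
  swap
  · intro J j
    simp only [mem_powersetCard, mem_sdiff, mem_univ, subset_univ, true_and, subset_erase,
      and_comm]
  have hcard : ∀ j : ι, #(univ.erase j) = Fintype.card ι - 1 := fun j => by
    rw [card_erase_of_mem (mem_univ j), card_univ]
  have hcard' : ((Fintype.card ι - 1 : ℕ) : ℝ) = (Fintype.card ι : ℝ) - 1 := by
    rw [Nat.cast_sub (by omega), Nat.cast_one]
  have h2 : ∀ j ∈ (univ : Finset ι), ∑ J ∈ (univ.erase j).powersetCard k, F j J
      ≤ (Fintype.card ι - 1).choose k * Real.exp (-E) := by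
    intro j _
    have := card_filter_sum_ge_le (univ.erase j) (k := k) (avg := avg) (by rw [hcard]; omega)
      (fun i => x i j) (fun i _ => hx0 i j) (fun i hi => hxM i j (ne_of_mem_erase hi)) hM ht
      (by rw [hcard, hcard']; exact havg j) hE
    rw [hcard, card_filter] at this
    push_cast at this
    exact this
  -- Since `n * choose (n - 1) k = (k + 1) * choose n (k + 1)`, the union bound costs a factor `k +
  -- 1`, not `n`.
  refine (sum_le_sum h2).trans (le_of_eq ?_)
  rw [sum_const, card_univ, nsmul_eq_mul, ← mul_assoc]
  congr 1
  obtain ⟨N, hN⟩ : ∃ N, Fintype.card ι = N + 1 := ⟨Fintype.card ι - 1, by omega⟩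
  rw [hN, Nat.add_sub_cancel]
  have := Nat.add_one_mul_choose_eq N k
  have h3 := congrArg (Nat.cast : ℕ → ℝ) this
  push_cast at h3 ⊢
  linarith

end Tail

/-! ### Decoupling a quadratic form into off-diagonal blocks. -/

section Decoupling

variable {ι : Type*} [DecidableEq ι]

lemma card_filter_powerset_mem_notMem (I : Finset ι) {i j : ι} (hi : i ∈ I) (hj : j ∈ I)
    (hij : i ≠ j) : 4 * #(I.powerset.filter fun T => i ∈ T ∧ j ∉ T) = 2 ^ #I := by
  have h : I.powerset.filter (fun T => i ∈ T ∧ j ∉ T)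
      = ((I.erase i).erase j).powerset.image (insert i) := by
    ext T
    simp only [mem_filter, mem_powerset, mem_image]
    constructor
    · rintro ⟨hT, hiT, hjT⟩
      refine ⟨T.erase i, ?_, insert_erase hiT⟩
      intro a ha
      simp only [mem_erase] at ha ⊢
      exact ⟨fun h => hjT (h ▸ ha.2), ha.1, hT ha.2⟩
    · rintro ⟨S, hS, rfl⟩
      refine ⟨insert_subset hi (hS.trans ((erase_subset _ _).trans (erase_subset _ _))),
        mem_insert_self _ _, ?_⟩
      rw [mem_insert, not_or]
      exact ⟨hij.symm, fun h => by simpa using hS h⟩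
  have hinj : Set.InjOn (insert i) (((I.erase i).erase j).powerset : Set (Finset ι)) := by
    intro S hS S' hS' heq
    have hn : ∀ S ∈ (((I.erase i).erase j).powerset : Set (Finset ι)), i ∉ S := fun S hS h => by
      have := (mem_powerset.1 (mem_coe.1 hS)) h
      simp at this
    rw [← erase_insert (hn S hS), ← erase_insert (hn S' hS'), heq]
  rw [h, card_image_of_injOn hinj, card_powerset, card_erase_of_mem (by simp [hj, hij.symm]),
    card_erase_of_mem hi]
  have h2 : 2 ≤ #I := by
    have := card_le_card (show ({i, j} : Finset ι) ⊆ I by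
      intro a; simp only [mem_insert, mem_singleton]; rintro (rfl | rfl) <;> assumption)
    rwa [card_pair hij] at this
  obtain ⟨r, hr⟩ : ∃ r, #I = r + 2 := ⟨#I - 2, by omega⟩
  rw [hr, show r + 2 - 1 - 1 = r by omega]; ring

/-- A random `T ⊆ I` separates an ordered pair `i ≠ j` (`i` inside, `j` outside) with probability
`1/4`. -/
lemma sum_powerset_sum_sdiff (I : Finset ι) (f : ι → ι → ℝ) (hf : ∀ i, f i i = 0) :
    4 * ∑ T ∈ I.powerset, ∑ i ∈ T, ∑ j ∈ I \ T, f i j = 2 ^ #I * ∑ i ∈ I, ∑ j ∈ I, f i j := by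
  have h1 : ∀ T ∈ I.powerset, ∑ i ∈ T, ∑ j ∈ I \ T, f i j
      = ∑ i ∈ I, ∑ j ∈ I, if i ∈ T ∧ j ∉ T then f i j else 0 := by
    intro T hT
    have hTI := mem_powerset.1 hT
    have e1 : I.filter (· ∈ T) = T := by rw [filter_mem_eq_inter, inter_eq_right.2 hTI]
    have e2 : I.filter (· ∉ T) = I \ T := filter_notMem_eq_sdiff
    conv_lhs => rw [← e2]
    conv_lhs => rw [← e1, sum_filter]
    refine sum_congr rfl fun i _ => ?_
    rw [e1]
    by_cases hi : i ∈ T <;> simp [hi, sum_filter]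
  rw [sum_congr rfl h1, sum_comm, mul_sum, mul_sum]
  refine sum_congr rfl fun i hi => ?_
  rw [sum_comm, mul_sum, mul_sum]
  refine sum_congr rfl fun j hj => ?_
  by_cases hij : i = j
  · subst hij; simp [hf]
  · rw [← sum_filter, sum_const, nsmul_eq_mul, ← mul_assoc]
    congr 1
    exact_mod_cast card_filter_powerset_mem_notMem I hi hj hij

/-- Column `j` of `H` with the coordinates outside `T` set to `0`. -/
def maskCol (H : Matrix ι ι ℝ) (T : Finset ι) (j i : ι) : ℝ :=
  if i ∈ T then H i j else 0

variable [Fintype ι]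

lemma maskCol_dotProduct (H : Matrix ι ι ℝ) (T : Finset ι) (j : ι) (x : ι → ℝ) :
    maskCol H T j ⬝ᵥ x = ∑ i ∈ T, H i j * x i := by
  simp [dotProduct, maskCol, ite_mul]

lemma maskCol_dotProduct_self (H : Matrix ι ι ℝ) (T : Finset ι) (j : ι) :
    maskCol H T j ⬝ᵥ maskCol H T j = ∑ i ∈ T, H i j ^ 2 := by
  rw [maskCol_dotProduct]
  exact sum_congr rfl fun i hi => by simp [maskCol, hi, sq]

/-- Decoupling of the quadratic form of a matrix with zero diagonal. -/
lemma quadForm_pow_le_sum_trace (H : Matrix ι ι ℝ) (hH : ∀ i, H i i = 0) (I : Finset ι)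
    (x : ι → ℝ) {q : ℕ} (hq : q ≠ 0) :
    (∑ i ∈ I, ∑ j ∈ I, x i * H i j * x j) ^ (2 * q) ≤ (∑ i ∈ I, x i ^ 2) ^ (2 * q) *
      (4 ^ q / 2 ^ #I * ∑ T ∈ I.powerset, (rankOneSum (maskCol H T) (I \ T) ^ q).trace) := by
  set β : Finset ι → ℝ := fun T => ∑ i ∈ T, ∑ j ∈ I \ T, x i * H i j * x j with hβ
  set y := ∑ i ∈ I, x i ^ 2 with hy
  have hy0 : 0 ≤ y := sum_nonneg fun i _ => sq_nonneg _
  have hdec : ∑ i ∈ I, ∑ j ∈ I, x i * H i j * x j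
      = 4 * ∑ T ∈ I.powerset, (1 / 2 ^ #I : ℝ) * β T := by
    have := sum_powerset_sum_sdiff I (fun i j => x i * H i j * x j) (fun i => by simp [hH])
    rw [← mul_sum, mul_left_comm, this]
    field_simp
  have hβle : ∀ T ∈ I.powerset,
      β T ^ (2 * q) ≤ (y ^ 2 / 4) ^ q * (rankOneSum (maskCol H T) (I \ T) ^ q).trace := by
    intro T hT
    have hTI := mem_powerset.1 hT
    set S := rankOneSum (maskCol H T) (I \ T) with hS
    have hSpsd : S.PosSemidef := rankOneSum_posSemidef _ _
    set xT : ι → ℝ := fun i => if i ∈ T then x i else 0 with hxT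
    have hxx : xT ⬝ᵥ xT = ∑ i ∈ T, x i ^ 2 := by
      simp [dotProduct, hxT, sq]
    -- Cauchy–Schwarz over the columns `j ∈ I \ T`; the second factor becomes a quadratic form of
    -- the rank-one sum.
    have hcs : β T ^ 2 ≤ (∑ j ∈ I \ T, x j ^ 2) * (xT ⬝ᵥ (S *ᵥ xT)) := by
      have e : β T = ∑ j ∈ I \ T, x j * (maskCol H T j ⬝ᵥ xT) := by
        simp only [hβ]
        rw [sum_comm]
        refine sum_congr rfl fun j _ => ?_
        rw [maskCol_dotProduct, mul_sum]
        exact sum_congr rfl fun i hi => by simp only [hxT, hi, if_true]; ring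
      rw [e, hS, dotProduct_rankOneSum_mulVec]
      exact sum_mul_sq_le_sq_mul_sq _ _ _
    have hsplit : ∑ j ∈ I \ T, x j ^ 2 + ∑ i ∈ T, x i ^ 2 = y := sum_sdiff hTI
    have h1 : 0 ≤ ∑ j ∈ I \ T, x j ^ 2 := sum_nonneg fun i _ => sq_nonneg _
    have h2 : 0 ≤ ∑ j ∈ T, x j ^ 2 := sum_nonneg fun i _ => sq_nonneg _
    calc β T ^ (2 * q) = (β T ^ 2) ^ q := pow_mul _ _ _
      _ ≤ ((∑ j ∈ I \ T, x j ^ 2) * (xT ⬝ᵥ (S *ᵥ xT))) ^ q := pow_le_pow_left₀ (sq_nonneg _) hcs _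
      _ = (∑ j ∈ I \ T, x j ^ 2) ^ q * (xT ⬝ᵥ (S *ᵥ xT)) ^ q := mul_pow _ _ _
      _ ≤ (∑ j ∈ I \ T, x j ^ 2) ^ q * ((xT ⬝ᵥ xT) ^ q * (S ^ q).trace) :=
          mul_le_mul_of_nonneg_left (dotProduct_mulVec_pow_le_trace hSpsd xT hq)
            (pow_nonneg h1 _)
      _ = ((∑ j ∈ I \ T, x j ^ 2) * ∑ j ∈ T, x j ^ 2) ^ q * (S ^ q).trace := by
          rw [hxx, mul_pow]; ring
      _ ≤ (y ^ 2 / 4) ^ q * (S ^ q).trace := by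
          refine mul_le_mul_of_nonneg_right (pow_le_pow_left₀ (mul_nonneg h1 h2) ?_ _)
            (trace_pow_nonneg hSpsd q)
          rw [← hsplit]
          -- By the inequality of means the product of the two parts of `y` is at most `y² / 4`.
          -- This halves the exponent of the factor `4 ^ (2 * q)` coming from decoupling.
          nlinarith [sq_nonneg (∑ j ∈ I \ T, x j ^ 2 - ∑ j ∈ T, x j ^ 2)]
  have hjensen : (∑ T ∈ I.powerset, (1 / 2 ^ #I : ℝ) * β T) ^ (2 * q)
      ≤ ∑ T ∈ I.powerset, (1 / 2 ^ #I : ℝ) * β T ^ (2 * q) := by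
    refine Real.pow_arith_mean_le_arith_mean_pow_of_even _ _ _ (fun _ _ => by positivity) ?_
      (even_two_mul q)
    rw [sum_const, card_powerset, nsmul_eq_mul]; push_cast; field_simp
  rw [hdec, mul_pow]
  calc (4 : ℝ) ^ (2 * q) * (∑ T ∈ I.powerset, (1 / 2 ^ #I : ℝ) * β T) ^ (2 * q)
      ≤ 4 ^ (2 * q) * ∑ T ∈ I.powerset, (1 / 2 ^ #I : ℝ) *
          ((y ^ 2 / 4) ^ q * (rankOneSum (maskCol H T) (I \ T) ^ q).trace) := by
        refine mul_le_mul_of_nonneg_left (hjensen.trans (sum_le_sum fun T hT => ?_))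
          (by positivity)
        exact mul_le_mul_of_nonneg_left (hβle T hT) (by positivity)
    _ = _ := by
        simp only [← mul_sum, div_pow]
        rw [pow_mul y, pow_mul (4 : ℝ)]
        have : ((4 : ℝ) ^ 2) ^ q = 4 ^ q * 4 ^ q := by rw [← mul_pow]; norm_num
        rw [this]
        field_simp

end Decoupling

/-! ### Choosing a subset and a splitting of it, in the other order. -/

section SplitSums

variable {ι : Type*} [DecidableEq ι] [Fintype ι]

/-- With `T` chosen first, `J = I \ T` runs over all subsets of the complement of given size, so for
fixed `T` the columns are again a uniform sample. -/
lemma sum_powersetCard_sum_powerset (k : ℕ) (F : Finset ι → Finset ι → ℝ) :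
    ∑ I ∈ (univ : Finset ι).powersetCard k, ∑ T ∈ I.powerset, F T (I \ T)
      = ∑ s ∈ range (k + 1), ∑ T ∈ (univ : Finset ι).powersetCard s,
          ∑ J ∈ (univ \ T).powersetCard (k - s), F T J := by
  have h1 : ∀ I ∈ (univ : Finset ι).powersetCard k, ∑ T ∈ I.powerset, F T (I \ T)
      = ∑ s ∈ range (k + 1), ∑ T ∈ I.powersetCard s, F T (I \ T) := by
    intro I hI
    rw [sum_powerset, (mem_powersetCard.1 hI).2]
  rw [sum_congr rfl h1, sum_comm]
  refine sum_congr rfl fun s hs => ?_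
  have hsk : s ≤ k := by have := mem_range.1 hs; omega
  rw [sum_sigma', sum_sigma']
  refine sum_bij' (fun p _ => ⟨p.2, p.1 \ p.2⟩) (fun p _ => ⟨p.1 ∪ p.2, p.1⟩) ?_ ?_ ?_ ?_ ?_
  · rintro ⟨I, T⟩ h
    simp only [mem_sigma, mem_powersetCard, subset_univ, true_and] at h ⊢
    exact ⟨h.2.2, sdiff_subset_sdiff (subset_univ _) le_rfl,
      by rw [card_sdiff_of_subset h.2.1, h.1, h.2.2]⟩
  · rintro ⟨T, J⟩ h
    simp only [mem_sigma, mem_powersetCard, subset_univ, true_and] at h ⊢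
    have hd : Disjoint T J := disjoint_of_subset_right h.2.1 disjoint_sdiff
    exact ⟨by rw [card_union_of_disjoint hd, h.1, h.2.2]; omega, subset_union_left, h.1⟩
  · rintro ⟨I, T⟩ h
    simp only [mem_sigma, mem_powersetCard] at h
    simp [union_eq_right.2 h.2.1]
  · rintro ⟨T, J⟩ h
    simp only [mem_sigma, mem_powersetCard] at h
    have hd : Disjoint T J := disjoint_of_subset_right h.2.1 disjoint_sdiff
    simp [union_sdiff_cancel_left hd]
  · rintro ⟨I, T⟩ _
    rfl

end SplitSums

/-! ### Moments of random blocks of a matrix: columns first, then rows. -/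

section MomentBounds

variable {ι : Type*} [DecidableEq ι] [Fintype ι]

lemma max_pow_le_add_pow {x y : ℝ} (hx : 0 ≤ x) (hy : 0 ≤ y) (q : ℕ) :
    max x y ^ q ≤ x ^ q + y ^ q := by
  rcases le_total x y with h | h
  · rw [max_eq_right h]; exact le_add_of_nonneg_left (by positivity)
  · rw [max_eq_left h]; exact le_add_of_nonneg_right (by positivity)

/-- The masked column, replaced by `0` when its squared norm exceeds `R`. -/
noncomputable def truncCol (H : Matrix ι ι ℝ) (R : ℝ) (T : Finset ι) (j : ι) : ι → ℝ :=
  if maskCol H T j ⬝ᵥ maskCol H T j ≤ R then maskCol H T j else 0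

/-- A block and its transpose have the same norm. With `u` the combination of rows, `|u|² = ∑ xᵢ (H
i ⬝ᵥ u)` over `T`, so Cauchy–Schwarz gives `|u|⁴ ≤ |x|² uᵀSu ≤ |x|² lam |u|²`. -/
lemma sum_row_combination_sq_le (H : Matrix ι ι ℝ) (T : Finset ι) {q : ℕ} (hq : q ≠ 0) {lam : ℝ}
    (hlam0 : 0 ≤ lam) (hlam : lam ^ q = (rankOneSum (fun i => H i) T ^ q).trace) (x : ι → ℝ) :
    ∑ j, (∑ i ∈ T, H i j * x i) ^ 2 ≤ lam * (x ⬝ᵥ x) := by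
  set S := rankOneSum (fun i => H i) T with hS
  have hSpsd : S.PosSemidef := rankOneSum_posSemidef _ _
  set u : ι → ℝ := fun j => ∑ i ∈ T, H i j * x i with hu
  have huu : ∑ j, (∑ i ∈ T, H i j * x i) ^ 2 = u ⬝ᵥ u := by simp [dotProduct, hu, sq]
  rw [huu]
  have hu0 := dotProduct_self_nonneg u
  have hx0 := dotProduct_self_nonneg x
  have h1 : u ⬝ᵥ (S *ᵥ u) ≤ lam * (u ⬝ᵥ u) := by
    refine le_of_pow_le_pow_left₀ hq (mul_nonneg hlam0 hu0) ?_
    rw [mul_pow, hlam, mul_comm]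
    exact dotProduct_mulVec_pow_le_trace hSpsd u hq
  have h2 : u ⬝ᵥ u = ∑ i ∈ T, x i * (H i ⬝ᵥ u) := by
    simp only [dotProduct, mul_sum]
    rw [sum_comm]
    refine sum_congr rfl fun j _ => ?_
    simp only [hu, sum_mul]
    exact sum_congr rfl fun i _ => by ring
  have h3 : (u ⬝ᵥ u) ^ 2 ≤ (x ⬝ᵥ x) * (u ⬝ᵥ (S *ᵥ u)) := by
    have hxT : ∑ i ∈ T, x i ^ 2 ≤ x ⬝ᵥ x := by
      simp only [dotProduct, ← sq]
      exact sum_le_sum_of_subset_of_nonneg (subset_univ _) fun _ _ _ => sq_nonneg _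
    rw [hS, dotProduct_rankOneSum_mulVec]
    calc (u ⬝ᵥ u) ^ 2 ≤ (∑ i ∈ T, x i ^ 2) * ∑ i ∈ T, (H i ⬝ᵥ u) ^ 2 := by
          rw [h2]; exact sum_mul_sq_le_sq_mul_sq _ _ _
      _ ≤ _ := mul_le_mul_of_nonneg_right hxT (sum_nonneg fun _ _ => sq_nonneg _)
  rcases hu0.eq_or_lt with h | h
  · rw [← h]; positivity
  · refine le_of_mul_le_mul_right ?_ h
    nlinarith

/-- Moments of the truncated off-diagonal block with rows in `T` and random columns. -/
lemma sum_trace_truncCol_pow_le (H : Matrix ι ι ℝ) {R ρ : ℝ} (hR : 0 ≤ R) (hρ : 0 ≤ ρ) {q k : ℕ}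
    (hq : q ≠ 0) (hk : k ≤ Fintype.card ι)
    (hkρ : (k : ℝ) ≤ ρ * ((Fintype.card ι : ℝ) - k + 1)) (T : Finset ι) (hT : #T ≤ k) :
    ∑ J ∈ (univ \ T).powersetCard (k - #T), (rankOneSum (truncCol H R T) J ^ q).trace
      ≤ (Fintype.card ι - #T).choose (k - #T) *
        (k * ((q * R) ^ q + (3 * ρ) ^ q * (rankOneSum (fun i => H i) T ^ q).trace)) := by
  set t := (rankOneSum (fun i => H i) T ^ q).trace with ht
  have ht0 : 0 ≤ t := trace_pow_nonneg (rankOneSum_posSemidef _ _) q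
  -- This bounds the squared norm of the rows in `T`, and its `q`-th power is a trace that can later
  -- be averaged over `T`.
  set lam : ℝ := t ^ ((q : ℝ)⁻¹) with hlamdef
  have hlam0 : 0 ≤ lam := Real.rpow_nonneg ht0 _
  have hlamq : lam ^ q = t := Real.rpow_inv_natCast_pow ht0 hq
  have hcard : #(univ \ T) = Fintype.card ι - #T := by
    rw [card_sdiff_of_subset (subset_univ _), card_univ]
  have hcol : ∀ j x, (truncCol H R T j ⬝ᵥ x) ^ 2 ≤ (∑ i ∈ T, H i j * x i) ^ 2 := by
    intro j x
    unfold truncCol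
    split_ifs
    · rw [maskCol_dotProduct]
    · rw [zero_dotProduct, zero_pow two_ne_zero]; positivity
  have hlam : ∀ x, ∑ j ∈ univ \ T, (truncCol H R T j ⬝ᵥ x) ^ 2 ≤ lam * (x ⬝ᵥ x) := by
    intro x
    refine le_trans ?_ (sum_row_combination_sq_le H T hq hlam0 hlamq x)
    exact (sum_le_sum fun j _ => hcol j x).trans
      (sum_le_sum_of_subset_of_nonneg (subset_univ _) fun _ _ _ => sq_nonneg _)
  -- The columns are supported in `T`, so testing `hlam` on the `#T` coordinate vectors suffices.
  have hW : ∑ j ∈ univ \ T, truncCol H R T j ⬝ᵥ truncCol H R T j ≤ #T * lam := by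
    have e1 : ∀ j, truncCol H R T j ⬝ᵥ truncCol H R T j
        = ∑ i ∈ T, (truncCol H R T j ⬝ᵥ Pi.single i 1) ^ 2 := by
      intro j
      simp only [dotProduct_single, mul_one]
      rw [dotProduct, ← sum_subset (subset_univ T)]
      · exact sum_congr rfl fun i _ => (sq _).symm
      · intro i _ hi
        unfold truncCol
        split_ifs <;> simp [maskCol, hi]
    simp only [e1]
    rw [sum_comm]
    refine (sum_le_card_nsmul T _ lam fun i _ => ?_).trans (by rw [nsmul_eq_mul])
    simpa using hlam (Pi.single i 1)
  have hTk : (#T : ℝ) ≤ k := by exact_mod_cast hT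
  set K := max (q * R) (3 * ρ * lam) with hKdef
  have hK1 : q * R ≤ K := le_max_left _ _
  have hK2 : 3 * ρ * lam ≤ K := le_max_right _ _
  have hmain := sum_trace_rankOneSum_pow_le (univ \ T) (truncCol H R T) (R := R) (lam := lam)
    (ρ := ρ) (K := K) (D := k) (q := q) (k := k - #T) hR hρ (Nat.cast_nonneg k)
    (fun j _ => by
      unfold truncCol
      split_ifs with h
      · exact h
      · simpa using hR) hlam hlam0 (by rw [hcard]; omega)
    (by
      rw [hcard, Nat.cast_sub hT, Nat.cast_sub (hT.trans hk)]
      have : (0 : ℝ) ≤ #T := Nat.cast_nonneg _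
      have e : (Fintype.card ι : ℝ) - #T - (k - #T) + 1 = (Fintype.card ι : ℝ) - k + 1 := by ring
      rw [e]; linarith) hK1 (by linarith)
    (by
      have h1 : ρ * (#T * lam) ≤ k * (ρ * lam) := by
        have := mul_le_mul_of_nonneg_right hTk (mul_nonneg hρ hlam0)
        linarith
      have h2 : ρ * lam ≤ K := by have := mul_nonneg hρ hlam0; linarith
      calc _ ≤ ρ * (#T * lam) := mul_le_mul_of_nonneg_left hW hρ
        _ ≤ k * (ρ * lam) := h1
        _ ≤ k * K := mul_le_mul_of_nonneg_left h2 (Nat.cast_nonneg k)) hq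
  rw [hcard] at hmain
  refine hmain.trans ?_
  have hKq : K ^ q ≤ (q * R) ^ q + (3 * ρ) ^ q * t := by
    refine (max_pow_le_add_pow (by positivity) (by positivity) q).trans ?_
    rw [mul_pow (3 * ρ), hlamq]
  gcongr

/-- Moments of the matrix formed by a random set of rows. -/
lemma sum_trace_rows_pow_le (H : Matrix ι ι ℝ) {R c ρ : ℝ} (hR : 0 ≤ R) (hρ : 0 ≤ ρ) {q k s : ℕ}
    (hq : 2 ≤ q) (hs : s ≤ k) (hk : k ≤ Fintype.card ι)
    (hkρ : (k : ℝ) ≤ ρ * ((Fintype.card ι : ℝ) - k + 1)) (hρN : ρ * Fintype.card ι ≤ 2 * k)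
    (hrow : ∀ i, H i ⬝ᵥ H i ≤ R) (hH : ∀ x, ∑ i, (H i ⬝ᵥ x) ^ 2 ≤ c ^ 2 * (x ⬝ᵥ x)) :
    ∑ T ∈ (univ : Finset ι).powersetCard s, (rankOneSum (fun i => H i) T ^ q).trace
      ≤ (Fintype.card ι).choose s * (k * ((q * R) ^ q + (3 * ρ * c ^ 2) ^ q)) := by
  set K := max (q * R) (3 * ρ * c ^ 2) with hKdef
  have hK1 : q * R ≤ K := le_max_left _ _
  have hK2 : 3 * ρ * c ^ 2 ≤ K := le_max_right _ _
  have hsk : (s : ℝ) ≤ k := by exact_mod_cast hs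
  have hq2 : (2 : ℝ) ≤ q := by exact_mod_cast hq
  have hmain := sum_trace_rankOneSum_pow_le univ (fun i => H i) (R := R) (lam := c ^ 2)
    (ρ := ρ) (K := K) (D := k) (q := q) (k := s) hR hρ (Nat.cast_nonneg k)
    (fun j _ => hrow j) hH (sq_nonneg c) (by rw [card_univ]; omega)
    (by
      rw [card_univ]
      have := mul_le_mul_of_nonneg_left
        (show (Fintype.card ι : ℝ) - k + 1 ≤ (Fintype.card ι : ℝ) - s + 1 by linarith) hρ
      linarith) hK1 (by linarith)
    (by
      have h1 : ∑ i, H i ⬝ᵥ H i ≤ Fintype.card ι * R := by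
        refine (sum_le_card_nsmul univ _ R fun i _ => hrow i).trans ?_
        rw [card_univ, nsmul_eq_mul]
      calc ρ * ∑ i, H i ⬝ᵥ H i ≤ ρ * (Fintype.card ι * R) := mul_le_mul_of_nonneg_left h1 hρ
        _ = ρ * Fintype.card ι * R := by ring
        _ ≤ 2 * k * R := mul_le_mul_of_nonneg_right hρN hR
        _ = k * (2 * R) := by ring
        _ ≤ k * (q * R) := by gcongr
        _ ≤ k * K := by gcongr) (by omega)
  rw [card_univ] at hmain
  refine hmain.trans ?_
  have := max_pow_le_add_pow (x := q * R) (y := 3 * ρ * c ^ 2) (by positivity) (by positivity) q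
  gcongr

/-- Moments of the decoupled truncated blocks, averaged over random subsets and their splittings. -/
lemma sum_sum_trace_truncCol_pow_le (H : Matrix ι ι ℝ) {R R' c ρ : ℝ} (hR : 0 ≤ R) (hR' : 0 ≤ R')
    (hρ : 0 ≤ ρ) {q k : ℕ} (hq : 2 ≤ q) (hk : k ≤ Fintype.card ι)
    (hkρ : (k : ℝ) ≤ ρ * ((Fintype.card ι : ℝ) - k + 1)) (hρN : ρ * Fintype.card ι ≤ 2 * k)
    (hrow : ∀ i, H i ⬝ᵥ H i ≤ R') (hH : ∀ x, ∑ i, (H i ⬝ᵥ x) ^ 2 ≤ c ^ 2 * (x ⬝ᵥ x)) :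
    ∑ I ∈ (univ : Finset ι).powersetCard k, ∑ T ∈ I.powerset,
        (rankOneSum (truncCol H R T) (I \ T) ^ q).trace
      ≤ 2 ^ k * (Fintype.card ι).choose k * (k * ((q * R) ^ q +
          (3 * ρ) ^ q * (k * ((q * R') ^ q + (3 * ρ * c ^ 2) ^ q)))) := by
  rw [sum_powersetCard_sum_powerset k
    (fun T J => (rankOneSum (truncCol H R T) J ^ q).trace)]
  set N := Fintype.card ι with hN
  set B := k * ((q * R) ^ q + (3 * ρ) ^ q * (k * ((q * R') ^ q + (3 * ρ * c ^ 2) ^ q))) with hB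
  have hs : ∀ s ∈ range (k + 1), ∑ T ∈ (univ : Finset ι).powersetCard s,
      ∑ J ∈ (univ \ T).powersetCard (k - s), (rankOneSum (truncCol H R T) J ^ q).trace
      ≤ (k.choose s : ℝ) * (N.choose k * B) := by
    intro s hs
    have hsk : s ≤ k := by have := mem_range.1 hs; omega
    have h1 : ∀ T ∈ (univ : Finset ι).powersetCard s,
        ∑ J ∈ (univ \ T).powersetCard (k - s), (rankOneSum (truncCol H R T) J ^ q).trace
        ≤ (N - s).choose (k - s) *
          (k * ((q * R) ^ q + (3 * ρ) ^ q * (rankOneSum (fun i => H i) T ^ q).trace)) := by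
      intro T hT
      have hTs := (mem_powersetCard.1 hT).2
      have := sum_trace_truncCol_pow_le H hR hρ (q := q) (by omega) hk hkρ T (by omega)
      rwa [hTs] at this
    refine (sum_le_sum h1).trans ?_
    have h2 := sum_trace_rows_pow_le H hR' hρ hq hsk hk hkρ hρN hrow hH
    have hch : (N.choose k : ℝ) * k.choose s = N.choose s * (N - s).choose (k - s) := by
      exact_mod_cast Nat.choose_mul hsk
    rw [← mul_sum, ← mul_sum, sum_add_distrib, sum_const, card_powersetCard, card_univ,
      nsmul_eq_mul, ← mul_sum]
    calc ((N - s).choose (k - s) : ℝ) * (k * (N.choose s * (q * R) ^ q + (3 * ρ) ^ q *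
            ∑ T ∈ (univ : Finset ι).powersetCard s, (rankOneSum (fun i => H i) T ^ q).trace))
        ≤ ((N - s).choose (k - s) : ℝ) * (k * (N.choose s * (q * R) ^ q + (3 * ρ) ^ q *
            (N.choose s * (k * ((q * R') ^ q + (3 * ρ * c ^ 2) ^ q))))) := by gcongr
      _ = (N.choose s * (N - s).choose (k - s)) * B := by rw [hB]; ring
      _ = _ := by rw [← hch]; ring
  refine (sum_le_sum hs).trans (le_of_eq ?_)
  rw [← sum_mul, ← Nat.cast_sum, Nat.sum_range_choose]
  push_cast; ring

end MomentBounds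

/-! ### Spectral norm and quadratic forms. -/

section SpectralNorm

open scoped Matrix.Norms.L2Operator

lemma norm_toLp_sq {n : Type*} [Fintype n] (x : n → ℝ) : ‖WithLp.toLp 2 x‖ ^ 2 = x ⬝ᵥ x := by
  rw [EuclideanSpace.real_norm_sq_eq]
  simp [dotProduct, sq]

variable {m n : Type*} [Fintype m] [Fintype n] [DecidableEq n]

lemma specNorm_nonneg (A : Matrix m n ℝ) : 0 ≤ specNorm A := norm_nonneg A

lemma mulVec_dotProduct_self_le (A : Matrix m n ℝ) (x : n → ℝ) :
    (A *ᵥ x) ⬝ᵥ (A *ᵥ x) ≤ specNorm A ^ 2 * (x ⬝ᵥ x) := by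
  have h : ‖WithLp.toLp 2 (A *ᵥ x)‖ ≤ specNorm A * ‖WithLp.toLp 2 x‖ :=
    l2_opNorm_mulVec A (WithLp.toLp 2 x)
  rw [← norm_toLp_sq, ← norm_toLp_sq, ← mul_pow]
  exact pow_le_pow_left₀ (norm_nonneg _) h 2

lemma specNorm_transpose [DecidableEq m] (A : Matrix m n ℝ) : specNorm Aᵀ = specNorm A := by
  have := l2_opNorm_conjTranspose A
  rwa [conjTranspose_eq_transpose_of_trivial] at this

lemma specNorm_le_of_mulVec {A : Matrix m n ℝ} {c : ℝ} (hc : 0 ≤ c)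
    (h : ∀ x, (A *ᵥ x) ⬝ᵥ (A *ᵥ x) ≤ c ^ 2 * (x ⬝ᵥ x)) : specNorm A ≤ c := by
  unfold specNorm
  rw [l2_opNorm_def]
  refine ContinuousLinearMap.opNorm_le_bound _ hc fun x => ?_
  have h1 : ‖WithLp.toLp 2 (A *ᵥ x.ofLp)‖ ≤ c * ‖WithLp.toLp 2 x.ofLp‖ := by
    refine le_of_pow_le_pow_left₀ two_ne_zero (by positivity) ?_
    rw [mul_pow, norm_toLp_sq, norm_toLp_sq]
    exact h _
  exact h1

/-- The spectral norm of a symmetric matrix is controlled by its quadratic form. -/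
lemma specNorm_le_of_quadForm {A : Matrix n n ℝ} (hA : Aᵀ = A) {c : ℝ} (hc : 0 ≤ c)
    (h : ∀ x, |x ⬝ᵥ (A *ᵥ x)| ≤ c * (x ⬝ᵥ x)) : specNorm A ≤ c := by
  have hsymm : ∀ x y, x ⬝ᵥ (A *ᵥ y) = y ⬝ᵥ (A *ᵥ x) := fun x y => by
    rw [dotProduct_mulVec, ← mulVec_transpose, hA, dotProduct_comm]
  have hpol : ∀ x y, 2 * (y ⬝ᵥ (A *ᵥ x)) ≤ c * (x ⬝ᵥ x + y ⬝ᵥ y) := by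
    intro x y
    have h1 := (abs_le.1 (h (x + y))).2
    have h2 := (abs_le.1 (h (x - y))).1
    simp only [mulVec_add, mulVec_sub, dotProduct_add, add_dotProduct, dotProduct_sub,
      sub_dotProduct] at h1 h2
    have h3 := hsymm x y
    have h4 := dotProduct_comm x y
    rw [h3, h4] at h1 h2
    linarith
  refine specNorm_le_of_mulVec hc fun x => ?_
  set w := A *ᵥ x with hw
  have hw0 := dotProduct_self_nonneg w
  rcases hc.eq_or_lt with rfl | hc
  · have := hpol x w
    rw [← hw] at this
    linarith
  -- The scaling `1 / c` balances the two sides of the polarized bound, giving `|w|² ≤ c²|x|²`.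
  · have := hpol x ((1 / c) • w)
    rw [← hw] at this
    simp only [smul_dotProduct, dotProduct_smul, smul_eq_mul] at this
    have e : c * (x ⬝ᵥ x + 1 / c * (1 / c * (w ⬝ᵥ w))) = c * (x ⬝ᵥ x) + 1 / c * (w ⬝ᵥ w) := by
      field_simp
    rw [e] at this
    have h5 : 1 / c * (w ⬝ᵥ w) ≤ c * (x ⬝ᵥ x) := by linarith
    have h6 := mul_le_mul_of_nonneg_left h5 hc.le
    have h7 : c * (1 / c * (w ⬝ᵥ w)) = w ⬝ᵥ w := by field_simp
    rw [h7] at h6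
    linarith

end SpectralNorm

/-! ### The off-diagonal Gram matrix. -/

section Gram

variable {m N : ℕ}

/-- The Gram matrix of the columns minus the identity. -/
def gramOff (Φ : Matrix (Fin m) (Fin N) ℝ) : Matrix (Fin N) (Fin N) ℝ :=
  Φᵀ * Φ - 1

lemma gramOff_transpose (Φ : Matrix (Fin m) (Fin N) ℝ) : (gramOff Φ)ᵀ = gramOff Φ := by
  simp [gramOff, transpose_mul]

lemma gramOff_symm (Φ : Matrix (Fin m) (Fin N) ℝ) (i j : Fin N) :
    gramOff Φ i j = gramOff Φ j i :=
  congrFun (congrFun (gramOff_transpose Φ) j) i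

lemma gramOff_self {Φ : Matrix (Fin m) (Fin N) ℝ} (hΦ : UnitColumns Φ) (i : Fin N) :
    gramOff Φ i i = 0 := by
  have := hΦ i
  simp only [gramOff, Matrix.sub_apply, mul_apply, transpose_apply, one_apply_eq, ← sq, this,
    sub_self]

lemma gramOff_sq (Φ : Matrix (Fin m) (Fin N) ℝ) {i j : Fin N} (hij : i ≠ j) :
    gramOff Φ i j ^ 2 = coh Φ i j ^ 2 := by
  simp [gramOff, coh, mul_apply, one_apply_ne hij, sq_abs]

lemma coh_nonneg (Φ : Matrix (Fin m) (Fin N) ℝ) (i j : Fin N) : 0 ≤ coh Φ i j := abs_nonneg _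

lemma coh_le_mutualCoherence (Φ : Matrix (Fin m) (Fin N) ℝ) {i j : Fin N} (hij : i ≠ j) :
    coh Φ i j ≤ mutualCoherence Φ :=
  le_ciSup (f := fun p : {p : Fin N × Fin N // p.1 ≠ p.2} => coh Φ p.1.1 p.1.2)
    (Set.finite_range _).bddAbove ⟨(i, j), hij⟩

lemma sum_coh_sq_le_meanSqCoherence (Φ : Matrix (Fin m) (Fin N) ℝ) (j : Fin N) :
    1 / ((N : ℝ) - 1) * ∑ i ∈ univ.erase j, coh Φ i j ^ 2 ≤ meanSqCoherence Φ :=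
  le_ciSup (f := fun j : Fin N => 1 / ((N : ℝ) - 1) * ∑ i ∈ univ.erase j, coh Φ i j ^ 2)
    (Set.finite_range _).bddAbove j

lemma sum_erase_gramOff_sq (Φ : Matrix (Fin m) (Fin N) ℝ) (j : Fin N) :
    ∑ i ∈ univ.erase j, gramOff Φ i j ^ 2 = ∑ i ∈ univ.erase j, coh Φ i j ^ 2 :=
  sum_congr rfl fun _ hi => gramOff_sq Φ (ne_of_mem_erase hi)

lemma gramOff_row_dotProduct_self {Φ : Matrix (Fin m) (Fin N) ℝ} (hΦ : UnitColumns Φ)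
    (j : Fin N) :
    gramOff Φ j ⬝ᵥ gramOff Φ j = ∑ i ∈ univ.erase j, coh Φ i j ^ 2 := by
  rw [← sum_erase_gramOff_sq, sum_erase _ (by simp [gramOff_self hΦ])]
  exact sum_congr rfl fun _ _ => by rw [gramOff_symm, sq]

lemma one_le_specNorm_sq {Φ : Matrix (Fin m) (Fin N) ℝ} (hΦ : UnitColumns Φ) (j : Fin N) :
    1 ≤ specNorm Φ ^ 2 := by
  have h := mulVec_dotProduct_self_le Φ (Pi.single j 1)
  have e : Φ *ᵥ Pi.single j 1 = fun t => Φ t j := by ext t; simp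
  rw [e] at h
  have h1 : (fun t => Φ t j) ⬝ᵥ (fun t => Φ t j) = 1 := by
    simpa [dotProduct, sq] using hΦ j
  rw [h1] at h
  simpa using h

/-- The eigenvalues of `ΦᵀΦ - 1` lie between `-1` and `‖Φ‖² - 1`, and `‖Φ‖² ≥ 1` because the columns
are unit vectors. The two final cases decide which end dominates. -/
lemma gramOff_mulVec_dotProduct_self_le {Φ : Matrix (Fin m) (Fin N) ℝ} (hΦ : UnitColumns Φ)
    (x : Fin N → ℝ) :
    (gramOff Φ *ᵥ x) ⬝ᵥ (gramOff Φ *ᵥ x) ≤ (specNorm Φ ^ 2) ^ 2 * (x ⬝ᵥ x) := by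
  rcases isEmpty_or_nonempty (Fin N) with hN | ⟨⟨j⟩⟩
  · simp [dotProduct]
  set c := specNorm Φ ^ 2 with hc
  have hc1 : 1 ≤ c := one_le_specNorm_sq hΦ j
  set u := Φ *ᵥ x with hu
  have hx0 := dotProduct_self_nonneg x
  have hu0 := dotProduct_self_nonneg u
  have h1 : u ⬝ᵥ u ≤ c * (x ⬝ᵥ x) := mulVec_dotProduct_self_le Φ x
  have h2 : (Φᵀ *ᵥ u) ⬝ᵥ (Φᵀ *ᵥ u) ≤ c * (u ⬝ᵥ u) := by
    have := mulVec_dotProduct_self_le Φᵀ u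
    rwa [specNorm_transpose] at this
  have h3 : (Φᵀ *ᵥ u) ⬝ᵥ x = u ⬝ᵥ u := by
    rw [mulVec_transpose, ← dotProduct_mulVec]
  have e : gramOff Φ *ᵥ x = Φᵀ *ᵥ u - x := by
    rw [gramOff, sub_mulVec, one_mulVec, hu, mulVec_mulVec]
  rw [e]
  simp only [sub_dotProduct, dotProduct_sub]
  rw [dotProduct_comm x, h3]
  rcases le_total c 2 with h | h
  · nlinarith
  · nlinarith [mul_le_mul_of_nonneg_left h1 (sub_nonneg.2 h)]

lemma colSub_gram_eq (Φ : Matrix (Fin m) (Fin N) ℝ) (I : Finset (Fin N)) :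
    (colSub Φ I)ᵀ * colSub Φ I - 1
      = (gramOff Φ).submatrix (fun i : I => (i : Fin N)) (fun i : I => (i : Fin N)) := by
  ext i j
  simp only [gramOff, colSub, mul_apply, one_apply, Subtype.ext_iff, Matrix.sub_apply,
    transpose_apply, submatrix_apply, id]

/-- The Gram deviation is controlled by the quadratic form of the off-diagonal Gram matrix. -/
lemma gramDev_le_of_quadForm (Φ : Matrix (Fin m) (Fin N) ℝ) (I : Finset (Fin N)) {c : ℝ}
    (hc : 0 ≤ c)
    (h : ∀ x : Fin N → ℝ, |∑ i ∈ I, ∑ j ∈ I, x i * gramOff Φ i j * x j| ≤ c * ∑ i ∈ I, x i ^ 2) :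
    gramDev Φ I ≤ c := by
  unfold gramDev
  rw [show (colSub Φ I).transpose * colSub Φ I - 1 = _ from colSub_gram_eq Φ I]
  refine specNorm_le_of_quadForm ?_ hc fun x => ?_
  · rw [transpose_submatrix, gramOff_transpose]
  · set y : Fin N → ℝ := fun i => if hi : i ∈ I then x ⟨i, hi⟩ else 0 with hy
    have hyx : ∀ i : I, y i = x i := fun i => by simp [hy]
    have h1 : x ⬝ᵥ x = ∑ i ∈ I, y i ^ 2 := by
      rw [← sum_coe_sort I]
      simp [dotProduct, hyx, sq]
    have h2 : x ⬝ᵥ ((gramOff Φ).submatrix (fun i : I => (i : Fin N))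
        (fun i : I => (i : Fin N)) *ᵥ x) = ∑ i ∈ I, ∑ j ∈ I, y i * gramOff Φ i j * y j := by
      rw [← sum_coe_sort I]
      refine sum_congr rfl fun i _ => ?_
      rw [← sum_coe_sort I]
      simp only [dotProduct, mulVec, hyx, submatrix_apply, mul_sum, mul_assoc]
    rw [h1, h2]
    exact h y

lemma gramDev_nonneg (Φ : Matrix (Fin m) (Fin N) ℝ) (I : Finset (Fin N)) : 0 ≤ gramDev Φ I :=
  specNorm_nonneg _

lemma gramDev_le_specNorm_sq {Φ : Matrix (Fin m) (Fin N) ℝ} (hΦ : UnitColumns Φ)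
    (I : Finset (Fin N)) : gramDev Φ I ≤ specNorm Φ ^ 2 := by
  refine gramDev_le_of_quadForm Φ I (sq_nonneg _) fun x => ?_
  set y : Fin N → ℝ := fun i => if i ∈ I then x i else 0 with hy
  have h1 : ∑ i ∈ I, x i ^ 2 = y ⬝ᵥ y := by simp [dotProduct, hy, sq]
  have h2 : ∑ i ∈ I, ∑ j ∈ I, x i * gramOff Φ i j * x j = y ⬝ᵥ (gramOff Φ *ᵥ y) := by
    simp [dotProduct, mulVec, hy, mul_sum, mul_assoc]
  rw [h1, h2]
  have hy0 := dotProduct_self_nonneg y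
  refine abs_le_of_sq_le_sq ?_ (mul_nonneg (sq_nonneg _) hy0)
  have hcs : (y ⬝ᵥ (gramOff Φ *ᵥ y)) ^ 2
      ≤ (y ⬝ᵥ y) * ((gramOff Φ *ᵥ y) ⬝ᵥ (gramOff Φ *ᵥ y)) := by
    have := sum_mul_sq_le_sq_mul_sq univ y (gramOff Φ *ᵥ y)
    simpa [dotProduct, sq] using this
  have := mul_le_mul_of_nonneg_left (gramOff_mulVec_dotProduct_self_le hΦ y) hy0
  nlinarith

/-- The factor multiplying `(∑ xᵢ²)^{2q}` in the decoupled bound does not depend on `x`, so its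
`2q`-th root bounds the quadratic form and hence the norm. -/
lemma gramDev_pow_le_sum_trace {Φ : Matrix (Fin m) (Fin N) ℝ} (hΦ : UnitColumns Φ)
    (I : Finset (Fin N)) {q : ℕ} (hq : q ≠ 0) :
    gramDev Φ I ^ (2 * q) ≤ 4 ^ q / 2 ^ #I *
      ∑ T ∈ I.powerset, (rankOneSum (maskCol (gramOff Φ) T) (I \ T) ^ q).trace := by
  set B : ℝ := 4 ^ q / 2 ^ #I *
      ∑ T ∈ I.powerset, (rankOneSum (maskCol (gramOff Φ) T) (I \ T) ^ q).trace with hB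
  have hB0 : 0 ≤ B := mul_nonneg (by positivity)
    (sum_nonneg fun T _ => trace_pow_nonneg (rankOneSum_posSemidef _ _) q)
  have h2q : 2 * q ≠ 0 := by omega
  set c : ℝ := B ^ (((2 * q : ℕ) : ℝ)⁻¹) with hc
  have hc0 : 0 ≤ c := Real.rpow_nonneg hB0 _
  have hcq : c ^ (2 * q) = B := Real.rpow_inv_natCast_pow hB0 h2q
  rw [← hcq]
  refine pow_le_pow_left₀ (gramDev_nonneg Φ I) (gramDev_le_of_quadForm Φ I hc0 fun x => ?_) _
  refine le_of_pow_le_pow_left₀ h2q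
    (mul_nonneg hc0 (sum_nonneg fun i _ => sq_nonneg _)) ?_
  rw [(even_two_mul q).pow_abs, mul_pow, hcq, mul_comm B]
  exact quadForm_pow_le_sum_trace (gramOff Φ) (gramOff_self hΦ) I x hq

/-- For `j ∈ I \ T` one has `T ⊆ I.erase j`, so no masked column exceeds the truncation level. -/
lemma rankOneSum_maskCol_eq_truncCol (H : Matrix (Fin N) (Fin N) ℝ) {R : ℝ} {I T : Finset (Fin N)}
    (hT : T ⊆ I) (hI : ∀ j ∈ I, ∑ i ∈ I.erase j, H i j ^ 2 ≤ R) :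
    rankOneSum (maskCol H T) (I \ T) = rankOneSum (truncCol H R T) (I \ T) := by
  refine sum_congr rfl fun j hj => ?_
  obtain ⟨hjI, hjT⟩ := mem_sdiff.1 hj
  have : maskCol H T j ⬝ᵥ maskCol H T j ≤ R := by
    rw [maskCol_dotProduct_self]
    refine le_trans (sum_le_sum_of_subset_of_nonneg ?_ fun _ _ _ => sq_nonneg _) (hI j hjI)
    exact fun i hi => mem_erase.2 ⟨fun h => hjT (h ▸ hi), hT hi⟩
  rw [truncCol, if_pos this]

lemma isStRIP_of_forall_lt (Φ : Matrix (Fin m) (Fin N) ℝ) {k : ℕ} {δ ε : ℝ} (hε : 0 < ε)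
    (h : ∀ I : Finset (Fin N), #I = k → gramDev Φ I < δ) : IsStRIP Φ k δ ε := by
  unfold IsStRIP probSubset
  rw [filter_eq_empty_iff.2]
  · simpa using hε
  · intro I hI hle
    exact absurd hle (not_le.2 (h I (mem_powersetCard.1 hI).2))

end Gram

/-! ### Numerical constants. -/

section Numerics

/-- These are the bases of the three `q`-th powers in the moment bound: the truncation level, the
row lengths, and the norm term with `κ = (2k/N)‖Φ‖²`. Each must be at most `δ²/e`, so that Markov's
inequality gains `e^{-q}`. -/
lemma moment_constants_le {a b c δ κ L : ℝ} {q : ℕ} (ha : a ∈ Set.Ioo (0 : ℝ) 1)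
    (hb : b ∈ Set.Ioo (0 : ℝ) 1) (hκ : 0 ≤ κ) (hL : 0.69 ≤ L) (hq : (q : ℝ) ≤ 6 * L + 1)
    (h : Real.sqrt b + Real.sqrt (2 * a * b) + Real.sqrt c + κ
      ≤ Real.exp (-1 / 4) * δ / (6 * Real.sqrt 2)) :
    4 * (q * (b / L)) ≤ δ ^ 2 / Real.exp 1 ∧ 24 * (q * (a * b / L)) ≤ δ ^ 2 / Real.exp 1 ∧
      36 * κ ^ 2 ≤ δ ^ 2 / Real.exp 1 := by
  obtain ⟨ha0, ha1⟩ := ha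
  obtain ⟨hb0, hb1⟩ := hb
  have hL0 : 0 < L := by linarith
  set B := Real.sqrt b with hB
  set A := Real.sqrt (2 * a * b) with hA
  have hB0 : 0 ≤ B := Real.sqrt_nonneg _
  have hA0 : 0 ≤ A := Real.sqrt_nonneg _
  have hBsq : B ^ 2 = b := Real.sq_sqrt hb0.le
  have hAsq : A ^ 2 = 2 * a * b := Real.sq_sqrt (by positivity)
  set Y := B + A + κ with hY
  have hY0 : 0 ≤ Y := by positivity
  have hYle : Y ≤ Real.exp (-1 / 4) * δ / (6 * Real.sqrt 2) := by
    have := Real.sqrt_nonneg c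
    linarith
  -- Squaring the hypothesis gives `Y² ≤ (e^{1/2} / 72) δ²/e`, and `72 / 1.65 > 43`.
  have hYsq : 43 * Y ^ 2 ≤ δ ^ 2 / Real.exp 1 := by
    have h1 : Y ^ 2 ≤ (Real.exp (-1 / 4) * δ / (6 * Real.sqrt 2)) ^ 2 :=
      pow_le_pow_left₀ hY0 hYle 2
    have h2 : (Real.exp (-1 / 4) * δ / (6 * Real.sqrt 2)) ^ 2
        = Real.exp (-1 / 2) * δ ^ 2 / 72 := by
      rw [div_pow, mul_pow, mul_pow, Real.sq_sqrt (by norm_num), ← Real.exp_nat_mul]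
      norm_num
    have h3 : Real.exp (1 / 2) ≤ 1.65 := by
      refine le_of_pow_le_pow_left₀ two_ne_zero (by norm_num) ?_
      rw [← Real.exp_nat_mul]
      norm_num
      linarith [Real.exp_one_lt_d9]
    have h4 : Real.exp (-1 / 2) = Real.exp (1 / 2) * (1 / Real.exp 1) := by
      rw [one_div (Real.exp 1), ← Real.exp_neg, ← Real.exp_add]; norm_num
    have h5 : 0 ≤ δ ^ 2 / Real.exp 1 := by positivity
    have h6 : Real.exp (-1 / 2) * δ ^ 2 / 72 = Real.exp (1 / 2) * (δ ^ 2 / Real.exp 1) / 72 := by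
      rw [h4]; ring
    have h7 := mul_le_mul_of_nonneg_right h3 h5
    rw [h2, h6] at h1
    linarith
  -- From `L ≥ 0.69` one has `6L + 1 ≤ 7.45 L`.
  have hqL : ∀ z : ℝ, 0 ≤ z → q * (z / L) ≤ 7.45 * z := by
    intro z hz
    have : (q : ℝ) ≤ 7.45 * L := by linarith
    rw [mul_div_assoc', div_le_iff₀ hL0]
    nlinarith
  have hBY : B ^ 2 ≤ Y ^ 2 := pow_le_pow_left₀ hB0 (by linarith) 2
  have hκY : κ ^ 2 ≤ Y ^ 2 := pow_le_pow_left₀ hκ (by linarith) 2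
  -- This yields `(3/2) A ≤ A + B ≤ Y`. The plain bound `A ≤ Y` would be too weak, as the second
  -- inequality needs `89.4 A² ≤ 43 Y²`.
  have hAB : A ≤ 2 * B := by
    refine le_of_pow_le_pow_left₀ two_ne_zero (by positivity) ?_
    rw [mul_pow, hAsq, hBsq]; nlinarith
  have hAY : (3 / 2 * A) ^ 2 ≤ Y ^ 2 := pow_le_pow_left₀ (by positivity) (by linarith) 2
  have hb' := hqL b hb0.le
  have hab' := hqL (a * b) (by positivity)
  refine ⟨?_, ?_, ?_⟩ <;> nlinarith

end Numerics

/-! ### Probabilities of the two bad events. -/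

section Main

variable {m N : ℕ}

/-- Markov's inequality for the `2q`-th power. On `P` the truncation is inactive, so the truncated
moments may be used and then extended by positivity to all `k`-subsets. -/
lemma card_filter_gramDev_ge_mul_le {Φ : Matrix (Fin m) (Fin N) ℝ} (hΦ : UnitColumns Φ)
    {R ρ δ : ℝ} (hR : 0 ≤ R) (hδ : 0 ≤ δ) (hρ : 0 ≤ ρ) {q k : ℕ} (hq : 2 ≤ q) (hk : k ≤ N)
    (hN : 1 ≤ N) (hμ0 : 0 ≤ meanSqCoherence Φ)
    (hkρ : (k : ℝ) ≤ ρ * ((N : ℝ) - k + 1)) (hρN : ρ * N ≤ 2 * k)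
    (P : Finset (Finset (Fin N))) (hP : P ⊆ univ.powersetCard k)
    (hPdev : ∀ I ∈ P, δ ≤ gramDev Φ I)
    (hPR : ∀ I ∈ P, ∀ j ∈ I, ∑ i ∈ I.erase j, gramOff Φ i j ^ 2 ≤ R) :
    (#P : ℝ) * δ ^ (2 * q) ≤ 4 ^ q * (N.choose k * (k * ((q * R) ^ q +
      (3 * ρ) ^ q * (k * ((q * (((N : ℝ) - 1) * meanSqCoherence Φ)) ^ q
        + (3 * ρ * (specNorm Φ ^ 2) ^ 2) ^ q))))) := by
  have hN1 : (1 : ℝ) ≤ N := by exact_mod_cast hN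
  have hrow : ∀ i, gramOff Φ i ⬝ᵥ gramOff Φ i ≤ ((N : ℝ) - 1) * meanSqCoherence Φ := by
    intro i
    rw [gramOff_row_dotProduct_self hΦ]
    -- For `N = 1` the factor `1 / (N - 1)` is `0` and gives no information, but the sum is empty.
    rcases hN1.eq_or_lt with h | h
    · have hN' : N = 1 := by exact_mod_cast h.symm
      subst hN'
      have : (univ : Finset (Fin 1)).erase i = ∅ := by
        ext j; simp [Subsingleton.elim j i]
      rw [this]; simp
    · have := sum_coh_sq_le_meanSqCoherence Φ i
      rwa [one_div, inv_mul_le_iff₀ (by linarith)] at this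
  have hH : ∀ x, ∑ i, (gramOff Φ i ⬝ᵥ x) ^ 2 ≤ (specNorm Φ ^ 2) ^ 2 * (x ⬝ᵥ x) := by
    intro x
    refine le_trans (le_of_eq ?_) (gramOff_mulVec_dotProduct_self_le hΦ x)
    exact sum_congr rfl fun i _ => sq _
  have hmom := sum_sum_trace_truncCol_pow_le (gramOff Φ) hR
    (mul_nonneg (by linarith) hμ0) hρ hq (k := k) (by simpa using hk) (by simpa using hkρ)
    (by simpa using hρN) hrow hH
  rw [Fintype.card_fin] at hmom
  have hI : ∀ I ∈ P, δ ^ (2 * q) ≤ 4 ^ q / 2 ^ k *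
      ∑ T ∈ I.powerset, (rankOneSum (truncCol (gramOff Φ) R T) (I \ T) ^ q).trace := by
    intro I hIP
    have h1 := gramDev_pow_le_sum_trace hΦ I (q := q) (by omega)
    rw [(mem_powersetCard.1 (hP hIP)).2] at h1
    have h2 := pow_le_pow_left₀ hδ (hPdev I hIP) (2 * q)
    refine h2.trans (h1.trans (le_of_eq ?_))
    congr 1
    refine sum_congr rfl fun T hT => ?_
    rw [rankOneSum_maskCol_eq_truncCol _ (mem_powerset.1 hT) (hPR I hIP)]
  rw [← nsmul_eq_mul]
  refine (card_nsmul_le_sum P _ _ hI).trans ?_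
  refine (sum_le_sum_of_subset_of_nonneg hP fun I _ _ => mul_nonneg (by positivity)
    (sum_nonneg fun T _ => trace_pow_nonneg (rankOneSum_posSemidef _ _) q)).trans ?_
  rw [← mul_sum]
  refine (mul_le_mul_of_nonneg_left hmom (by positivity)).trans (le_of_eq ?_)
  field_simp

/-- With probability at least `1 - ε / 4`, no column in a random subset is strongly correlated
with the others. -/
lemma card_filter_large_correlation_le (Φ : Matrix (Fin m) (Fin N) ℝ) {k' : ℕ}
    (hkN : k' + 1 ≤ N) {ε a b L : ℝ} (ha1 : a < 1) (hb0 : 0 < b)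
    (hε0 : 0 < ε) (hLdef : L = Real.log (1 / ε)) (hL0 : 0 < L)
    (hk2 : (2 : ℝ) ≤ ((k' + 1 : ℕ) : ℝ)) (hkε : ((k' + 1 : ℕ) : ℝ) < 1 / ε)
    (hμbar0 : 0 ≤ meanSqCoherence Φ)
    (hμ : ((k' + 1 : ℕ) : ℝ) * mutualCoherence Φ ^ 4 ≤ 1 / L ^ 2 *
      ((1 - a) ^ 2 * b ^ 2 / (32 * Real.log (2 * ((k' + 1 : ℕ) : ℝ)) * Real.log (Real.exp 1 / ε))))
    (hμbar : ((k' + 1 : ℕ) : ℝ) * meanSqCoherence Φ ≤ a * b / L) :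
    (#((univ.powersetCard (k' + 1)).filter fun I : Finset (Fin N) =>
        ∃ j ∈ I, b / L ≤ ∑ i ∈ I.erase j, gramOff Φ i j ^ 2) : ℝ)
      ≤ N.choose (k' + 1) * (ε / 4) := by
  have hexpL : Real.exp L = 1 / ε := by rw [hLdef]; exact Real.exp_log (by positivity)
  have hexpnL : Real.exp (-L) = ε := by rw [Real.exp_neg, hexpL]; simp
  set E : ℝ := 8 * (Real.log (2 * ((k' + 1 : ℕ) : ℝ)) * Real.log (Real.exp 1 / ε)) with hE
  have hlogε : Real.log (Real.exp 1 / ε) = 1 + L := by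
    rw [hLdef, Real.log_div (Real.exp_pos 1).ne' hε0.ne', Real.log_exp, one_div, Real.log_inv]
    ring
  have hlogk : 1 ≤ Real.log (2 * ((k' + 1 : ℕ) : ℝ)) := by
    rw [Real.le_log_iff_exp_le (by positivity)]
    linarith [Real.exp_one_lt_d9]
  -- The threshold `b/L` splits into the bound `ab/L` for the mean and this deviation. The
  -- hypothesis on the mutual coherence says exactly `4kμ⁴E ≤ t²`.
  set t : ℝ := (1 - a) * b / L with ht
  have ht0 : 0 < t := div_pos (mul_pos (by linarith) hb0) hL0
  have hRt : a * b / L + t = b / L := by rw [ht]; ring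
  have hbadG := card_filter_exists_sum_erase_ge_le (ι := Fin N) (k := k')
    (by simpa using hkN) (fun i j => gramOff Φ i j ^ 2)
    (M := mutualCoherence Φ ^ 2) (avg := a * b / L) (t := t) (E := E)
    (fun i j => sq_nonneg _)
    (fun i j hij => by
      rw [gramOff_sq Φ hij]
      exact pow_le_pow_left₀ (coh_nonneg Φ i j) (coh_le_mutualCoherence Φ hij) 2)
    (sq_nonneg _) ht0
    (fun j => by
      rw [Fintype.card_fin, sum_erase_gramOff_sq]
      have h1 := sum_coh_sq_le_meanSqCoherence Φ j
      calc (k' : ℝ) / ((N : ℝ) - 1) * ∑ i ∈ univ.erase j, coh Φ i j ^ 2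
          = k' * (1 / ((N : ℝ) - 1) * ∑ i ∈ univ.erase j, coh Φ i j ^ 2) := by ring
        _ ≤ k' * meanSqCoherence Φ := by gcongr
        _ ≤ ((k' + 1 : ℕ) : ℝ) * meanSqCoherence Φ := by gcongr; omega
        _ ≤ _ := hμbar)
    (by
      have h1 := hμ
      have hE0 : 0 < E := by
        have : 0 < Real.log (2 * ((k' + 1 : ℕ) : ℝ)) := by linarith
        rw [hE, hlogε]; positivity
      have h2 : 1 / L ^ 2 * ((1 - a) ^ 2 * b ^ 2 / (32 * Real.log (2 * ((k' + 1 : ℕ) : ℝ)) *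
            Real.log (Real.exp 1 / ε))) = t ^ 2 / (4 * E) := by
        have : Real.log (2 * ((k' + 1 : ℕ) : ℝ)) ≠ 0 := by linarith
        rw [ht, hE, hlogε]; field_simp; ring
      rw [h2, le_div_iff₀ (by positivity)] at h1
      have h3 : (k' : ℝ) * (mutualCoherence Φ ^ 2) ^ 2
          ≤ ((k' + 1 : ℕ) : ℝ) * mutualCoherence Φ ^ 4 := by
        rw [show (mutualCoherence Φ ^ 2) ^ 2 = mutualCoherence Φ ^ 4 by ring]
        exact mul_le_mul_of_nonneg_right (by push_cast; linarith) (by positivity)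
      have h4 := mul_le_mul_of_nonneg_right h3 (show 0 ≤ 4 * E by positivity)
      linarith)
  rw [Fintype.card_fin, hRt] at hbadG
  set C : ℝ := (N.choose (k' + 1) : ℝ) with hC
  have hC0 : 0 < C := by rw [hC]; exact_mod_cast Nat.choose_pos hkN
  have hexp2 : Real.exp (-2) ≤ 1 / 4 := by
    have h1 : (2 : ℝ) ≤ Real.exp 1 := by linarith [Real.exp_one_gt_d9]
    have h2 : (4 : ℝ) ≤ Real.exp 2 := by
      rw [show (2 : ℝ) = 1 + 1 by norm_num, Real.exp_add]; nlinarith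
    rw [Real.exp_neg, ← one_div]
    exact one_div_le_one_div_of_le (by norm_num) h2
  have hprobG : ((k' : ℝ) + 1) * C * Real.exp (-E) ≤ C * (ε / 4) := by
    have h1 : ((k' : ℝ) + 1) ≤ Real.exp L := by
      rw [hexpL]; push_cast at hkε; exact hkε.le
    -- One `e^{-L}` pays for the union bound, as `k' + 1 ≤ e^L`; the other is `ε`, and `e^{-2} ≤
    -- 1/4`.
    have h2 : -E ≤ -L + (-L + -2) := by
      have : 1 + L ≤ Real.log (2 * ((k' + 1 : ℕ) : ℝ)) * (1 + L) :=
        le_mul_of_one_le_left (by linarith) hlogk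
      rw [hE, hlogε]; linarith
    have h3 : Real.exp (-E) ≤ Real.exp (-L) * (Real.exp (-L) * Real.exp (-2)) := by
      rw [← Real.exp_add, ← Real.exp_add]; exact Real.exp_le_exp.2 h2
    calc ((k' : ℝ) + 1) * C * Real.exp (-E)
        ≤ Real.exp L * C * (Real.exp (-L) * (Real.exp (-L) * Real.exp (-2))) := by gcongr
      _ = (Real.exp L * Real.exp (-L)) * C * (ε * Real.exp (-2)) := by rw [hexpnL]; ring
      _ = C * (ε * Real.exp (-2)) := by rw [← Real.exp_add]; simp
      _ ≤ C * (ε * (1 / 4)) := by gcongr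
      _ = _ := by ring
  refine le_trans (le_of_eq ?_) (hbadG.trans hprobG)
  congr!

/-- Moment bound for the number of subsets without strongly correlated columns that have a large
Gram deviation. -/
lemma card_gramDev_ge_mul_exp_le {Φ : Matrix (Fin m) (Fin N) ℝ} (hΦ : UnitColumns Φ) {k q : ℕ}
    (hkN : 2 * k < N) {δ a b c L : ℝ} (ha : a ∈ Set.Ioo (0 : ℝ) 1) (hb : b ∈ Set.Ioo (0 : ℝ) 1)
    (hδ0 : 0 < δ) (hL : 0.69 ≤ L) (hq2 : (q : ℝ) ≤ 6 * L + 1) (hq4 : 2 ≤ q)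
    (hk1 : (1 : ℝ) ≤ k) (hμbar0 : 0 ≤ meanSqCoherence Φ)
    (hμbar : (k : ℝ) * meanSqCoherence Φ ≤ a * b / L)
    (habc : Real.sqrt b + Real.sqrt (2 * a * b) + Real.sqrt c
        + 2 * (k : ℝ) / (N : ℝ) * specNorm Φ ^ 2
      ≤ Real.exp (-1 / 4) * δ / (6 * Real.sqrt 2))
    (P : Finset (Finset (Fin N))) (hP : P ⊆ univ.powersetCard k)
    (hPdev : ∀ I ∈ P, δ ≤ gramDev Φ I)
    (hPR : ∀ I ∈ P, ∀ j ∈ I, ∑ i ∈ I.erase j, gramOff Φ i j ^ 2 ≤ b / L) :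
    (#P : ℝ) * Real.exp 1 ^ q ≤ N.choose k * (3 * k ^ 2) := by
  have hL0 : 0 < L := by linarith
  have hb0 := hb.1
  have hN2 : 2 * (k : ℝ) < N := by exact_mod_cast hkN
  have hN0 : (0 : ℝ) < N := by linarith
  have hκ0 : 0 ≤ 2 * (k : ℝ) / (N : ℝ) * specNorm Φ ^ 2 := by positivity
  obtain ⟨hc1, hc2, hc3⟩ := moment_constants_le ha hb hκ0 hL hq2 habc
  -- This value is admissible because `N > 2k` gives `N - k + 1 ≥ N / 2`.
  obtain ⟨ρ, hρ⟩ : ∃ ρ : ℝ, ρ = 2 * (k : ℝ) / N := ⟨_, rfl⟩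
  have hρN : ρ * N = 2 * (k : ℝ) := by rw [hρ]; field_simp
  have hρ0 : 0 ≤ ρ := by rw [hρ]; positivity
  rw [← hρ] at hc3
  have hkρ : (k : ℝ) ≤ ρ * ((N : ℝ) - k + 1) := by
    have := mul_le_mul_of_nonneg_left (show (N : ℝ) / 2 ≤ (N : ℝ) - k + 1 by linarith) hρ0
    linarith
  have hmom := card_filter_gramDev_ge_mul_le hΦ (R := b / L) (ρ := ρ) (δ := δ)
    (by positivity) hδ0.le hρ0 hq4 (by omega) (by omega) hμbar0 hkρ hρN.le P hP hPdev hPR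
  clear hP hPdev hPR habc hkρ
  obtain ⟨Δ, hΔ⟩ : ∃ Δ : ℝ, Δ = δ ^ 2 / Real.exp 1 := ⟨_, rfl⟩
  obtain ⟨R', hR'⟩ : ∃ R' : ℝ, R' = ((N : ℝ) - 1) * meanSqCoherence Φ := ⟨_, rfl⟩
  rw [← hΔ] at hc1 hc2 hc3
  rw [← hR'] at hmom
  have hΔ0 : 0 < Δ := by rw [hΔ]; positivity
  have hR'0 : 0 ≤ R' := by rw [hR']; exact mul_nonneg (by linarith) hμbar0
  have t1 : 4 ^ q * (q * (b / L)) ^ q ≤ Δ ^ q := by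
    rw [← mul_pow]; exact pow_le_pow_left₀ (by positivity) hc1 _
  have t2 : 4 ^ q * ((3 * ρ) ^ q * (q * R') ^ q) ≤ Δ ^ q := by
    rw [← mul_pow, ← mul_pow]
    refine pow_le_pow_left₀ (by positivity) (le_trans ?_ hc2) _
    have h1 : ρ * R' ≤ 2 * (a * b / L) := by
      calc ρ * R' ≤ ρ * (N * meanSqCoherence Φ) := by
            rw [hR']; gcongr; linarith
        _ = 2 * (k * meanSqCoherence Φ) := by rw [← mul_assoc, hρN]; ring
        _ ≤ _ := by linarith
    have h2 := mul_le_mul_of_nonneg_left h1 (Nat.cast_nonneg (α := ℝ) q)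
    linarith
  have t3 : 4 ^ q * ((3 * ρ) ^ q * (3 * ρ * (specNorm Φ ^ 2) ^ 2) ^ q) ≤ Δ ^ q := by
    rw [← mul_pow, ← mul_pow]
    exact pow_le_pow_left₀ (by positivity) (le_trans (le_of_eq (by ring)) hc3) _
  have hδq : δ ^ (2 * q) = Δ ^ q * Real.exp 1 ^ q := by
    rw [← mul_pow, hΔ, div_mul_cancel₀ _ (Real.exp_pos 1).ne', pow_mul]
  rw [hδq] at hmom
  have hk2 : (k : ℝ) ≤ k ^ 2 := by nlinarith
  have hC0 : (0 : ℝ) ≤ N.choose k := Nat.cast_nonneg _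
  have hpos : 0 < Δ ^ q := by positivity
  refine le_of_mul_le_mul_right ?_ hpos
  generalize (N.choose k : ℝ) = C at *
  calc (#P : ℝ) * Real.exp 1 ^ q * Δ ^ q = (#P : ℝ) * (Δ ^ q * Real.exp 1 ^ q) := by ring
    _ ≤ 4 ^ q * (C * (k * ((q * (b / L)) ^ q + (3 * ρ) ^ q * (k * ((q * R') ^ q
            + (3 * ρ * (specNorm Φ ^ 2) ^ 2) ^ q))))) := hmom
    _ = C * (k * (4 ^ q * (q * (b / L)) ^ q)
            + k ^ 2 * (4 ^ q * ((3 * ρ) ^ q * (q * R') ^ q))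
            + k ^ 2 * (4 ^ q * ((3 * ρ) ^ q * (3 * ρ * (specNorm Φ ^ 2) ^ 2) ^ q))) := by
          generalize (q * (b / L)) ^ q = x1
          generalize (q * R') ^ q = x2
          generalize (3 * ρ * (specNorm Φ ^ 2) ^ 2) ^ q = x3
          generalize (3 * ρ) ^ q = x4
          generalize (4 : ℝ) ^ q = x5
          ring
    _ ≤ C * (k ^ 2 * Δ ^ q + k ^ 2 * Δ ^ q + k ^ 2 * Δ ^ q) := by
          refine mul_le_mul_of_nonneg_left (add_le_add (add_le_add ?_ ?_) ?_) hC0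
          · exact (mul_le_mul_of_nonneg_left t1 (by positivity)).trans
              (mul_le_mul_of_nonneg_right hk2 hpos.le)
          · exact mul_le_mul_of_nonneg_left t2 (by positivity)
          · exact mul_le_mul_of_nonneg_left t3 (by positivity)
    _ = C * (3 * k ^ 2) * Δ ^ q := by ring

/-- With probability at least `1 - 3 ε / 8`, a random subset without strongly correlated columns
has small Gram deviation. -/
lemma card_gramDev_ge_le {Φ : Matrix (Fin m) (Fin N) ℝ} (hΦ : UnitColumns Φ) {k : ℕ}
    (hkN : 2 * k < N) {δ ε a b c L : ℝ} (ha : a ∈ Set.Ioo (0 : ℝ) 1) (hb : b ∈ Set.Ioo (0 : ℝ) 1)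
    (hδ0 : 0 < δ) (hε0 : 0 < ε) (hexpL : Real.exp L = 1 / ε) (hL : 0.69 ≤ L)
    (hk2 : (2 : ℝ) ≤ k) (hkε : (k : ℝ) < 1 / ε) (hμbar0 : 0 ≤ meanSqCoherence Φ)
    (hμbar : (k : ℝ) * meanSqCoherence Φ ≤ a * b / L)
    (habc : Real.sqrt b + Real.sqrt (2 * a * b) + Real.sqrt c
        + 2 * (k : ℝ) / (N : ℝ) * specNorm Φ ^ 2
      ≤ Real.exp (-1 / 4) * δ / (6 * Real.sqrt 2))
    (P : Finset (Finset (Fin N))) (hP : P ⊆ univ.powersetCard k)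
    (hPdev : ∀ I ∈ P, δ ≤ gramDev Φ I)
    (hPR : ∀ I ∈ P, ∀ j ∈ I, ∑ i ∈ I.erase j, gramOff Φ i j ^ 2 ≤ b / L) :
    (#P : ℝ) ≤ N.choose k * (3 / 8 * ε) := by
  -- With this order `e^q ≥ ε^{-6}`. The factor `k²` costs `ε^{-2}`, and `3ε⁴ ≤ 3ε/8` because `ε ≤
  -- 1/2`.
  have hq1 : 6 * L ≤ (⌈6 * L⌉₊ : ℕ) := Nat.le_ceil _
  have hq2 : ((⌈6 * L⌉₊ : ℕ) : ℝ) ≤ 6 * L + 1 := (Nat.ceil_lt_add_one (by linarith)).le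
  have hq4 : 2 ≤ ⌈6 * L⌉₊ := by
    have : (2 : ℝ) ≤ (⌈6 * L⌉₊ : ℕ) := by linarith
    exact_mod_cast this
  have h1 := card_gramDev_ge_mul_exp_le hΦ hkN ha hb hδ0 hL hq2 hq4 (by linarith) hμbar0 hμbar habc
    P hP hPdev hPR
  have hexpq : (1 / ε) ^ 6 ≤ Real.exp 1 ^ ⌈6 * L⌉₊ := by
    rw [← hexpL, ← Real.exp_nat_mul, ← Real.exp_nat_mul]
    exact Real.exp_le_exp.2 (by push_cast; linarith)
  have hC0 : (0 : ℝ) ≤ N.choose k := Nat.cast_nonneg _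
  generalize (N.choose k : ℝ) = C at *
  have h2 : (#P : ℝ) * (1 / ε) ^ 6 ≤ C * (3 * (1 / ε) ^ 2) := by
    calc (#P : ℝ) * (1 / ε) ^ 6 ≤ (#P : ℝ) * Real.exp 1 ^ ⌈6 * L⌉₊ := by gcongr
      _ ≤ C * (3 * k ^ 2) := h1
      _ ≤ _ := by gcongr
  have hε2 : ε ≤ 1 / 2 := by
    rw [lt_div_iff₀ hε0] at hkε
    have := mul_le_mul_of_nonneg_right hk2 hε0.le
    linarith
  have h3 : (#P : ℝ) ≤ C * (3 * ε ^ 4) := by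
    have e1 : (1 / ε) ^ 6 * ε ^ 6 = 1 := by field_simp
    have e2 : (1 / ε) ^ 2 * ε ^ 6 = ε ^ 4 := by field_simp
    have := mul_le_mul_of_nonneg_right h2 (show 0 ≤ ε ^ 6 by positivity)
    calc (#P : ℝ) = #P * (1 / ε) ^ 6 * ε ^ 6 := by rw [mul_assoc, e1, mul_one]
      _ ≤ C * (3 * (1 / ε) ^ 2) * ε ^ 6 := this
      _ = _ := by rw [← e2]; ring
  refine h3.trans (mul_le_mul_of_nonneg_left ?_ hC0)
  have : ε ^ 3 ≤ (1 / 2) ^ 3 := pow_le_pow_left₀ hε0.le hε2 3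
  calc 3 * ε ^ 4 = 3 * ε ^ 3 * ε := by ring
    _ ≤ 3 * (1 / 2) ^ 3 * ε := by gcongr
    _ = _ := by norm_num

end Main

end StRIP

theorem theorem1 {m N : ℕ} (Φ : Matrix (Fin m) (Fin N) ℝ) (hΦ : StRIP.UnitColumns Φ)
    (k : ℕ) (hk : 1 ≤ k) (hkN : k ≤ N) (δ ε a b c : ℝ)
    (ha : a ∈ Set.Ioo (0 : ℝ) 1) (hb : b ∈ Set.Ioo (0 : ℝ) 1) (hc : c ∈ Set.Ioo (0 : ℝ) 1)
    (hε0 : 0 < ε) (hε : ε < min (1 / (k : ℝ)) (Real.exp (1 - 1 / Real.log 2)))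
    (hμ : (k : ℝ) * StRIP.mutualCoherence Φ ^ 4 ≤
      1 / Real.log (1 / ε) ^ 2 *
        min ((1 - a) ^ 2 * b ^ 2 /
          (32 * Real.log (2 * (k : ℝ)) * Real.log (Real.exp 1 / ε))) (c ^ 2))
    (hμbar : (k : ℝ) * StRIP.meanSqCoherence Φ ≤ a * b / Real.log (1 / ε))
    (habc : Real.sqrt b + Real.sqrt (2 * a * b) + Real.sqrt c
        + 2 * (k : ℝ) / (N : ℝ) * StRIP.specNorm Φ ^ 2
      ≤ Real.exp (-1 / 4) * δ / (6 * Real.sqrt 2)) :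
    StRIP.IsStRIP Φ k δ ε := by
  classical
  have hk1 : (1 : ℝ) ≤ k := by exact_mod_cast hk
  have hkN' : (k : ℝ) ≤ N := by exact_mod_cast hkN
  have hN0 : (0 : ℝ) < N := by linarith
  have hκ0 : 0 ≤ 2 * (k : ℝ) / (N : ℝ) * StRIP.specNorm Φ ^ 2 := by positivity
  obtain ⟨ha0, ha1⟩ := ha
  obtain ⟨hb0, hb1⟩ := hb
  have hδκ : 2 * (k : ℝ) / (N : ℝ) * StRIP.specNorm Φ ^ 2 < δ := by
    have h1 : 0 < Real.sqrt b := Real.sqrt_pos.2 hb0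
    have h2 := Real.sqrt_nonneg (2 * a * b)
    have h3 := Real.sqrt_nonneg c
    have h4 : 1 ≤ 6 * Real.sqrt 2 := by
      have : 1 ≤ Real.sqrt 2 := Real.one_le_sqrt.2 (by norm_num)
      linarith
    have h5 : Real.exp (-1 / 4) ≤ 1 := Real.exp_le_one_iff.2 (by norm_num)
    have hpos : 0 < Real.exp (-1 / 4) * δ / (6 * Real.sqrt 2) := by linarith
    have hδ0 : 0 < δ := by
      by_contra hneg
      have : Real.exp (-1 / 4) * δ / (6 * Real.sqrt 2) ≤ 0 :=
        div_nonpos_of_nonpos_of_nonneg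
          (mul_nonpos_of_nonneg_of_nonpos (Real.exp_pos _).le (not_lt.1 hneg)) (by positivity)
      linarith
    have h6 : Real.exp (-1 / 4) * δ / (6 * Real.sqrt 2) ≤ δ := by
      rw [div_le_iff₀ (by positivity)]
      nlinarith
    linarith
  have hδ0 : 0 < δ := lt_of_le_of_lt hκ0 hδκ
  rcases Nat.lt_or_ge k 2 with hk2 | hk2
  · refine StRIP.isStRIP_of_forall_lt Φ hε0 fun I hI => lt_of_le_of_lt ?_ hδ0
    obtain ⟨i, rfl⟩ := Finset.card_eq_one.1 (show Finset.card I = 1 by omega)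
    refine StRIP.gramDev_le_of_quadForm Φ _ le_rfl fun x => ?_
    simp [StRIP.gramOff_self hΦ]
  rcases le_or_gt N (2 * k) with hN2 | hN2
  -- Here `2k/N ≥ 1`, so the deterministic bound `‖Φ‖²` is already below `δ`.
  · refine StRIP.isStRIP_of_forall_lt Φ hε0 fun I _ =>
      lt_of_le_of_lt (StRIP.gramDev_le_specNorm_sq hΦ I) (lt_of_le_of_lt ?_ hδκ)
    have h1 : 1 ≤ 2 * (k : ℝ) / N := by
      rw [le_div_iff₀ hN0, one_mul]; exact_mod_cast hN2
    nlinarith [sq_nonneg (StRIP.specNorm Φ)]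
  have hN2' : 2 * (k : ℝ) < N := by exact_mod_cast hN2
  have hk2' : (2 : ℝ) ≤ k := by exact_mod_cast hk2
  have hεk : ε < 1 / k := lt_of_lt_of_le hε (min_le_left _ _)
  set L := Real.log (1 / ε) with hLdef
  have hkε : (k : ℝ) < 1 / ε := by
    rw [lt_div_iff₀ hε0]; rw [lt_div_iff₀ (by linarith)] at hεk; linarith
  have hexpL : Real.exp L = 1 / ε := Real.exp_log (by positivity)
  have hL : 0.69 ≤ L := by
    have h1 : Real.log 2 ≤ L := Real.log_le_log (by norm_num) (by linarith)
    linarith [Real.log_two_gt_d9]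
  have hL0 : 0 < L := by linarith
  have hμbar0 : 0 ≤ StRIP.meanSqCoherence Φ := by
    refine Real.iSup_nonneg fun j => mul_nonneg ?_ (Finset.sum_nonneg fun i _ => sq_nonneg _)
    exact one_div_nonneg.2 (by linarith)
  obtain ⟨k', rfl⟩ : ∃ k', k = k' + 1 := ⟨k - 1, by omega⟩
  set Ω := Finset.powersetCard (k' + 1) (Finset.univ : Finset (Fin N)) with hΩ
  set P := Ω.filter (fun I => δ ≤ StRIP.gramDev Φ I ∧
    ∀ j ∈ I, ∑ i ∈ I.erase j, StRIP.gramOff Φ i j ^ 2 ≤ b / L) with hP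
  have hprobG := StRIP.card_filter_large_correlation_le Φ hkN ha1 hb0 hε0 hLdef hL0 hk2' hkε
    hμbar0 (hμ.trans (mul_le_mul_of_nonneg_left (min_le_left _ _) (by positivity))) hμbar
  have hprobP := StRIP.card_gramDev_ge_le hΦ hN2 ⟨ha0, ha1⟩ ⟨hb0, hb1⟩ hδ0 hε0 hexpL hL hk2' hkε
    hμbar0 hμbar habc P (Finset.filter_subset _ _)
    (fun I hI => (Finset.mem_filter.1 hI).2.1) (fun I hI => (Finset.mem_filter.1 hI).2.2)
  set C : ℝ := (N.choose (k' + 1) : ℝ) with hC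
  have hC0 : 0 < C := by rw [hC]; exact_mod_cast Nat.choose_pos hkN
  unfold StRIP.IsStRIP StRIP.probSubset
  rw [Finset.card_powersetCard, Finset.card_univ, Fintype.card_fin, div_lt_iff₀ hC0]
  have hsub : (Ω.filter fun I => I ∈ {I | δ ≤ StRIP.gramDev Φ I}) ⊆
      (Ω.filter fun I : Finset (Fin N) =>
        ∃ j ∈ I, b / L ≤ ∑ i ∈ I.erase j, StRIP.gramOff Φ i j ^ 2) ∪ P := by
    intro I hI
    obtain ⟨hIΩ, hdev⟩ := Finset.mem_filter.1 hI
    by_cases h : ∃ j ∈ I, b / L ≤ ∑ i ∈ I.erase j, StRIP.gramOff Φ i j ^ 2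
    · exact Finset.mem_union_left _ (Finset.mem_filter.2 ⟨hIΩ, h⟩)
    · push Not at h
      exact Finset.mem_union_right _ (Finset.mem_filter.2 ⟨hIΩ, hdev, fun j hj => (h j hj).le⟩)
  have hcard : (Finset.card (Ω.filter fun I => I ∈ {I | δ ≤ StRIP.gramDev Φ I}) : ℝ)
      ≤ C * (ε / 4) + C * (3 / 8 * ε) := by
    refine le_trans (b := ((Finset.card (Ω.filter fun I : Finset (Fin N) =>
        ∃ j ∈ I, b / L ≤ ∑ i ∈ I.erase j, StRIP.gramOff Φ i j ^ 2) : ℝ) + Finset.card P)) ?_ ?_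
    · exact_mod_cast (Finset.card_le_card hsub).trans (Finset.card_union_le _ _)
    · refine add_le_add (le_trans (le_of_eq ?_) hprobG) hprobP
      congr!
  refine lt_of_le_of_lt ?_ (lt_of_le_of_lt hcard ?_)
  · exact le_of_eq (by congr!)
  · have : 0 < C * ε := by positivity
    linarith
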